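/- Setting. There are $N$ users. User $i$ has a finite medium input alphabet $\mathcal I_i$ and a finite medium output alphabet $\mathcal O_i$. A medium is a sequence $m=\langle m^n\rangle_{n\ge1}$ of arbitrary transition probabilities $m^n:\prod_i\mathcal I_i^n\to\mathcal P(\prod_i\mathcal O_i^n)$; a compound medium is an arbitrary set $\mathcal B$ of media. For each ordered pair $(i,j)$, $1\le i,j\le N$, let $X_{ij}$ be a random variable on a finite set $\mathcal X_{ij}$, $\mathcal Y_{ij}$ a finite reproduction alphabet, $d_{ij}:\mathcal X_{ij}\times\mathcal Y_{ij}\to[0,\infty)$, $D_{ij}\in\mathbb R$, and $d^n_{ij}(x^n,y^n)=\sum_{t=1}^n d_{ij}(x^n(t),y^n(t))$. The sources $X_{ij}^n$ (i.i.d. copies of $X_{ij}$) are independent over the pairs $(i,j)$. Modems. At block-length $n$ the deterministic modem of user $i$ consists of an encoder, mapping the data at user $i$ destined to users $1,\dots,N$ to an element of $\mathcal I_i^n$, and a decoder, mapping that data and the medium output in $\mathcal O_i^n$ to reproductions of the data sent to user $i$ by users $1,\dots,N$. Random modems are, for each $n$, a joint probability distribution on the $N$-tuples of deterministic modems (shared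 randomness, independent of data and medium). Modems for the sources $X_{ij}$, not depending on $m\in\mathcal B$, communicate the sources within distortions $D_{ij}$ over $\mathcal B$ if there are $\omega_{ij,n}\ge0$ with $\omega_{ij,n}\to0$ as $n\to\infty$ and $$\Pr\Big(\tfrac1n d^n_{ij}(X^n_{ij},Y^n_{ij})>D_{ij}\Big)\le\omega_{ij,n}\qquad\text{for all } i,j,\ n\ge1,\ m\in\mathcal B,$$ where $Y_{ij}^n$ is the reproduction of $X_{ij}^n$ at user $j$. For rates $R_{ij}\ge0$ let $\mathcal M_{R}^n=\{1,\dots,2^{\lfloor nR\rfloor}\}$. Modems for messages $w_{ij}\in\mathcal M^n_{R_{ij}}$, with reproductions in $\mathcal M^n_{R_{ij}}\cup\{\mathsf e\}$ ($\mathsf e$ a declared error), not depending on $m\in\mathcal B$, communicate reliably at rates $R_{ij}$ over $\mathcal B$ if there are $\delta_{ij,n}\ge0$ with $\delta_{ij,n}\to0$ such that, for all $m\in\mathcal B$, $n\ge1$, all message tuples and all $i,j$, the message $w_{ij}$ is reproduced incorrectly with probability at most $\delta_{ij,n}$. Source codes. A random source code of rate $R$ for a source $X$ is, for each $n$, a joint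 distribution on pairs of an encoder $\mathcal X^n\to\mathcal M_R^n$ and a decoder $\mathcal M_R^n\to\mathcal Y^n$; it codes $X$ within $D$ if $\Pr(\frac1n d^n(X^n,Y^n)>D)\to0$. $R^P_X(D)\in[0,\infty]$ is the infimum of the rates $R\ge 0$ of random source codes which code $X$ within $D$ ($\infty$ if there are none). A separation architecture consists of random source codes of rates $R_{ij}$, one for each pair $(i,j)$ and independent of each other, and, independent of these, random modems for messages at rates $R_{ij}$: user $i$ source-encodes each $X_{ij}^n$, the message modems carry the resulting messages, and user $j$ source-decodes the reproduced message (the first message is used if an error is declared). Resources. A medium resource consumption at a user is any $[0,\infty]$-valued quantity determined by the sequence (in $n$) of the joint laws of the medium inputs. Theorem. (1) Suppose that some random modems $h$ communicate the sources $X_{ij}$ within distortions $D_{ij}$ over $\mathcal B$. Then for all rates $R_{ij}\ge0$ such that, for each pair, $R_{ij}<R^P_{X_{ij}}(D_{ij})$ or $R_{ij}=0$, there are random modems which communicate reliably from user $i$ to user $j$ at rates $R_{ij}$, $1\le i,j\le N$, simultaneously, over $\mathcal B$, and whose consumption of every medium resource at each user, for every joint distribution of the messages, is the same as or less than that of $h$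 when used with the sources $X_{ij}$. (2) Let $R_{ij}>R^P_{X_{ij}}(D_{ij})$ for all $i,j$. Then there are random source codes of rates $R_{ij}$, not depending on the compound medium, which code $X_{ij}$ within $D_{ij}$ and have the following property. Whenever random modems $h_c$ communicate reliably at rates $R_{ij}$ over a compound medium $\mathcal B$, the separation architecture made of these source codes and $h_c$ communicates the sources $X_{ij}$ within distortions $D_{ij}$ over $\mathcal B$, and its consumption of every medium resource at each user is the same as or less than that of $h_c$ when the messages of all the pairs are independent and uniformly distributed. -/

import Mathlib

open Filter Topology
open scoped NNReal ENNReal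

noncomputable section

namespace Unicast

/-- The joint law of independent random variables with laws `p k`. -/
def indep {ι : Type*} [Fintype ι] {α : ι → Type*} [∀ k, Finite (α k)]
    (p : ∀ k, PMF (α k)) : PMF (∀ k, α k) :=
  ⟨fun f => ∏ k, p k (f k), by
    classical
    have : ∀ k, Fintype (α k) := fun k => Fintype.ofFinite (α k)
    have h : ∑ f : (∀ k, α k), ∏ k, p k (f k) = 1 := by
      rw [← Fintype.piFinset_univ, ← Finset.prod_univ_sum]
      refine Finset.prod_eq_one fun k _ => ?_
      rw [← tsum_fintype (L := .unconditional _)]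
      exact (p k).tsum_coe
    exact h ▸ hasSum_fintype _⟩

/-- `n` independent copies of a random letter with law `p`. -/
def iid {X : Type*} [Finite X] (p : PMF X) (n : ℕ) : PMF (Fin n → X) :=
  indep fun _ : Fin n => p

/-- The per-letter additive distortion `(1/n) ∑ₜ d (x t) (y t)`. -/
def avgDist {X Y : Type*} (d : X → Y → ℝ≥0) {n : ℕ} (x : Fin n → X) (y : Fin n → Y) : ℝ :=
  (1 / (n : ℝ)) * ∑ t, (d (x t) (y t) : ℝ)

/-- The rate `R` message set at block-length `n`, with `2 ^ ⌊n R⌋` elements. -/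
abbrev Msg (R : ℝ≥0) (n : ℕ) : Type := Fin (2 ^ ⌊(n : ℝ≥0) * R⌋₊)

/-! ### Source codes and the operational rate-distortion function -/

/-- A deterministic source code of rate `R` and block-length `n`: (encoder, decoder). -/
abbrev DetSourceCode (X Y : Type*) (R : ℝ≥0) (n : ℕ) : Type _ :=
  ((Fin n → X) → Msg R n) × (Msg R n → (Fin n → Y))

/-- A random source code of rate `R`: for every block-length, a joint distribution on
deterministic (encoder, decoder) pairs. -/
abbrev SourceCode (X Y : Type*) (R : ℝ≥0) : Type _ := ∀ n, PMF (DetSourceCode X Y R n)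

/-- The random source code codes the i.i.d. `p` source to within distortion `D`:
the probability of excess distortion tends to zero. -/
def CodesWithin {X Y : Type*} [Finite X] (p : PMF X) (d : X → Y → ℝ≥0) (D : ℝ)
    {R : ℝ≥0} (s : SourceCode X Y R) : Prop :=
  Tendsto
    (fun n => ((s n).bind fun c => (iid p n).map fun x => (x, c.2 (c.1 x))).toOuterMeasure
      {xy | D < avgDist d xy.1 xy.2})
    atTop (𝓝 0)

/-- The operational rate-distortion function under the probability of excess distortion criterion:
the infimum of the rates at which the source can be coded to within `D`
(`∞` if there is no such rate). -/
def rateDistortion {X Y : Type*} [Finite X] (p : PMF X) (d : X → Y → ℝ≥0) (D : ℝ) : ℝ≥0∞ :=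
  ⨅ (R : ℝ≥0) (_ : ∃ s : SourceCode X Y R, CodesWithin p d D s), (R : ℝ≥0∞)

/-! ### Media and modems -/

section Network

variable {N : ℕ} (I O : Fin N → Type*)

/-- An `N`-user medium: for every block-length, a transition probability from the medium inputs
of all the users to the medium outputs at all the users.  A compound medium is a set of media. -/
abbrev Medium : Type _ := ∀ n : ℕ, (∀ i, Fin n → I i) → PMF (∀ i, Fin n → O i)

/-- The deterministic modems of all the users at block-length `n`, for data `S i j` to be sent from
user `i` to user `j` and reproduced there in `T i j`.  The modem of user `i` consists of an encoder,
which maps the data available at user `i` to the medium input at user `i`, and a decoder, which maps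
that data and the medium output at user `i` to the reproductions at user `i`. -/
abbrev DetModems (S T : Fin N → Fin N → Type*) (n : ℕ) : Type _ :=
  ∀ i, ((∀ j, S i j) → (Fin n → I i)) × ((∀ j, S i j) → (Fin n → O i) → (∀ j, T j i))

/-- Random modems: for every block-length, a joint distribution on the tuples of deterministic
modems of all the users. -/
abbrev Modems (S T : ℕ → Fin N → Fin N → Type*) : Type _ :=
  ∀ n, PMF (DetModems I O (S n) (T n) n)

/-- Modems for sources with alphabets `X i j` and reproduction alphabets `Y i j`. -/
abbrev SourceModems (X Y : Fin N → Fin N → Type*) : Type _ :=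
  Modems I O (fun n i j => Fin n → X i j) (fun n i j => Fin n → Y i j)

/-- Medium modems for messages at rates `R i j`; the reproduction `none` denotes a declared error. -/
abbrev MessageModems (R : Fin N → Fin N → ℝ≥0) : Type _ :=
  Modems I O (fun n i j => Msg (R i j) n) (fun n i j => Option (Msg (R i j) n))

variable {I O}

/-- The interconnection of random modems and a medium at block-length `n`, as a transition
probability from the data of all ordered pairs of users to their reproductions. -/
def interconnect {S T : Fin N → Fin N → Type*} {n : ℕ} (h : PMF (DetModems I O S T n))
    (m : (∀ i, Fin n → I i) → PMF (∀ i, Fin n → O i)) (s : ∀ i j, S i j) :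
    PMF (∀ i j, T i j) :=
  h.bind fun g => (m fun i => (g i).1 (s i)).map fun o i j => (g j).2 (s j) (o j) i

/-- The joint law of the medium inputs of all the users when the data have law `q`. -/
def inputLaw {S T : Fin N → Fin N → Type*} {n : ℕ} (h : PMF (DetModems I O S T n))
    (q : PMF (∀ i j, S i j)) : PMF (∀ i, Fin n → I i) :=
  h.bind fun g => q.map fun s i => (g i).1 (s i)

/-- The joint law of the independent i.i.d. sources with letter laws `p i j`. -/
def sourceLaw {X : Fin N → Fin N → Type*} [∀ i j, Finite (X i j)]
    (p : ∀ i j, PMF (X i j)) (n : ℕ) : PMF (∀ i j, Fin n → X i j) :=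
  indep fun i => indep fun j => iid (p i j) n

/-- The joint law of independent messages, each uniform on its message set. -/
def uniformMessages (R : Fin N → Fin N → ℝ≥0) (n : ℕ) : PMF (∀ i j, Msg (R i j) n) :=
  indep fun i => indep fun j => PMF.uniformOfFintype (Msg (R i j) n)

/-- The modems `h` communicate the independent i.i.d. `p i j` sources from user `i` to user `j` to
within distortions `D i j` over the compound medium `B`, uniformly over the media in `B`. -/
def Communicates {X Y : Fin N → Fin N → Type*} [∀ i j, Finite (X i j)] (B : Set (Medium I O))
    (p : ∀ i j, PMF (X i j)) (d : ∀ i j, X i j → Y i j → ℝ≥0) (D : Fin N → Fin N → ℝ)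
    (h : SourceModems I O X Y) : Prop :=
  ∃ ω : Fin N → Fin N → ℕ → ℝ≥0, (∀ i j, Tendsto (ω i j) atTop (𝓝 0)) ∧
    ∀ m ∈ B, ∀ n, 0 < n → ∀ i j,
      ((sourceLaw p n).bind fun x =>
        (interconnect (h n) (m n) x).map fun y => (x, y)).toOuterMeasure
          {xy | D i j < avgDist (d i j) (xy.1 i j) (xy.2 i j)} ≤ (ω i j n : ℝ≥0∞)

/-- The modems `h` communicate messages reliably from user `i` to user `j` at rates `R i j` over the
compound medium `B`: the maximal error probabilities tend to zero uniformly over the media in `B`. -/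
def Reliable {R : Fin N → Fin N → ℝ≥0} (B : Set (Medium I O)) (h : MessageModems I O R) : Prop :=
  ∃ δ : Fin N → Fin N → ℕ → ℝ≥0, (∀ i j, Tendsto (δ i j) atTop (𝓝 0)) ∧
    ∀ m ∈ B, ∀ n, 0 < n → ∀ (w : ∀ i j, Msg (R i j) n) (i j : Fin N),
      (interconnect (h n) (m n) w).toOuterMeasure {v | v i j ≠ some (w i j)} ≤ (δ i j n : ℝ≥0∞)

/-- Medium resource consumption at a user is a quantity determined by the law of the medium inputs
(as a sequence in the block-length).  An architecture with input laws `P` consumes the same or lesser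
medium resources at each user than one with input laws `Q` if this is so for every such quantity. -/
def SameOrLesserResources (P Q : ∀ n : ℕ, PMF (∀ i, Fin n → I i)) : Prop :=
  ∀ (ρ : Fin N → (∀ n : ℕ, PMF (∀ i, Fin n → I i)) → ℝ≥0∞) (i : Fin N), ρ i P ≤ ρ i Q

/-- Separation at the deterministic level: user `i` source-encodes each of its sources `j` by the
source code of the pair `(i, j)`, the medium modems carry the resulting messages, and user `i`
source-decodes each message reproduction by the source code of the pair `(j, i)`
(a declared error is replaced by the first message). -/
def sepDet {X Y : Fin N → Fin N → Type*} {R : Fin N → Fin N → ℝ≥0} {n : ℕ}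
    (c : ∀ i j, DetSourceCode (X i j) (Y i j) (R i j) n)
    (g : DetModems I O (fun i j => Msg (R i j) n) (fun i j => Option (Msg (R i j) n)) n) :
    DetModems I O (fun i j => Fin n → X i j) (fun i j => Fin n → Y i j) n :=
  fun i =>
    (fun x => (g i).1 fun j => (c i j).1 (x j),
     fun x o j => (c j i).2 (((g i).2 (fun k => (c i k).1 (x k)) o j).getD 0))

/-- The separation architecture made of random source codes, one for each ordered pair of users and
independent of each other, and of random medium modems, independent of the source codes. -/
def separation {X Y : Fin N → Fin N → Type*} [∀ i j, Finite (X i j)] [∀ i j, Finite (Y i j)]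
    {R : Fin N → Fin N → ℝ≥0} (s : ∀ i j, SourceCode (X i j) (Y i j) (R i j))
    (h : MessageModems I O R) : SourceModems I O X Y :=
  fun n => (indep fun i => indep fun j => s i j n).bind fun c => (h n).map fun g => sepDet c g

end Network

end Unicast

end

/-! Part (1) is random coding through the given source modems. Codewords are drawn i.i.d. from the
source law, the codewords of the messages are fed to `h` in place of the sources, and each message
is decoded as the unique one whose codeword passes a test against the reproduction. For every fixed
message tuple the sent codewords have exactly the source law. Hence the medium inputs have the same
law as under `h`, whatever the law of the messages, and the distortion guarantee of `h` applies to
the sent codewords. A codeword that was not sent is independent of the reproduction, so reliability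
(`error_le`) reduces to a packing bound: below the rate-distortion function, a typical source word
is within distortion D of a fixed reproduction with probability o(2^(-nR)), uniformly in the
reproduction (`exists_typical_sets`).

The packing bound comes from convex duality. By random covering, a channel of loss at most D and
small mutual information would give a source code of too small a rate, so no such channel exists.
Separation in the plane of pairs (loss, information) gives a multiplier l (`exists_lagrange`), and
optimality of an output law gives weights α with E[α(X) exp(-l d(X,y))] ≤ 1 for all y and E[log
α(X)] > ρ + lD (`exists_dual_certificate`). Markov's inequality and the law of large numbers finish.

The delicate case is D equal to the least expected distortion, where fluctuations of order √n could
ruin achievability. Since `h` works over some medium, the letterwise best reproduction meets D with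
probability tending to one. A centred non-degenerate walk is not asymptotically nonpositive, so
either there is slack in D or the least distortion is constantly D on the support
(`drift_neg_or_eq_zero`).

For part (2), a code of slightly smaller rate is dithered by a uniform shift shared by encoder and
decoder (`exists_uniform_code`). The messages become uniform and independent whatever the sources,
so the medium input laws coincide, and the excess-distortion probability is at most the source
code's plus the message error. -/

set_option linter.unusedSectionVars false

/-! ### Exponential moments and tails of sums of i.i.d. letters -/

section FiniteSums

variable {X Y : Type*} [Fintype X] [Fintype Y]

lemma sum_pi_prod {n : ℕ} (f : Fin n → X → ℝ) :
    ∑ x : Fin n → X, ∏ t, f t (x t) = ∏ t, ∑ a, f t a := by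
  classical
  rw [Finset.prod_univ_sum, Fintype.piFinset_univ]

lemma exists_abs_le_bound (g : X → ℝ) : ∃ M : ℝ, 1 ≤ M ∧ ∀ x, |g x| ≤ M := by
  refine ⟨∑ x, |g x| + 1, ?_, fun x => ?_⟩
  · have : 0 ≤ ∑ x, |g x| := Finset.sum_nonneg fun x _ => abs_nonneg _
    linarith
  · have := Finset.single_le_sum (f := fun x => |g x|) (fun x _ => abs_nonneg _)
      (Finset.mem_univ x)
    linarith

lemma weighted_sq_le {P g : X → ℝ} (hP : ∀ x, 0 ≤ P x) (hP1 : ∑ x, P x = 1) {M : ℝ}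
    (hM : ∀ x, |g x| ≤ M) : ∑ x, P x * g x ^ 2 ≤ M ^ 2 := by
  calc ∑ x, P x * g x ^ 2 ≤ ∑ x, P x * M ^ 2 := by
        refine Finset.sum_le_sum fun x _ => mul_le_mul_of_nonneg_left ?_ (hP x)
        exact sq_le_sq' (abs_le.1 (hM x)).1 (abs_le.1 (hM x)).2
    _ = M ^ 2 := by rw [← Finset.sum_mul, hP1, one_mul]

/-- An upper bound on the moment generating function near zero. -/
lemma mgf_le {P g : X → ℝ} (hP : ∀ x, 0 ≤ P x) (hP1 : ∑ x, P x = 1) {M s : ℝ}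
    (hM : ∀ x, |g x| ≤ M) (hs : 0 ≤ s) (hsM : s * M ≤ 1) :
    ∑ x, P x * Real.exp (s * g x) ≤ 1 + s * ∑ x, P x * g x + s ^ 2 * M ^ 2 := by
  have h1 : ∀ x, P x * Real.exp (s * g x)
      ≤ P x + s * (P x * g x) + s ^ 2 * (P x * g x ^ 2) := by
    intro x
    have hb : |s * g x| ≤ 1 := by
      rw [abs_mul, abs_of_nonneg hs]
      exact (mul_le_mul_of_nonneg_left (hM x) hs).trans hsM
    have := (abs_le.1 (Real.abs_exp_sub_one_sub_id_le hb)).2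
    nlinarith [mul_le_mul_of_nonneg_left this (hP x)]
  calc _ ≤ ∑ x, (P x + s * (P x * g x) + s ^ 2 * (P x * g x ^ 2)) :=
        Finset.sum_le_sum fun x _ => h1 x
    _ = 1 + s * ∑ x, P x * g x + s ^ 2 * ∑ x, P x * g x ^ 2 := by
        rw [Finset.sum_add_distrib, Finset.sum_add_distrib, hP1, Finset.mul_sum, Finset.mul_sum]
    _ ≤ _ := by
        have := mul_le_mul_of_nonneg_left (weighted_sq_le hP hP1 hM) (sq_nonneg s)
        linarith

/-- A lower bound on the moment generating function near zero. -/
lemma le_mgf {P g : X → ℝ} (hP : ∀ x, 0 ≤ P x) (hP1 : ∑ x, P x = 1) {M s : ℝ}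
    (hM : ∀ x, |g x| ≤ M) (hs : 0 ≤ s) (hsM : s * M ≤ 1) :
    1 + s * ∑ x, P x * g x + s ^ 2 / 4 * ∑ x, P x * g x ^ 2
      ≤ ∑ x, P x * Real.exp (s * g x) := by
  have h1 : ∀ x, P x + s * (P x * g x) + s ^ 2 / 4 * (P x * g x ^ 2)
      ≤ P x * Real.exp (s * g x) := by
    intro x
    have hb : |s * g x| ≤ 1 := by
      rw [abs_mul, abs_of_nonneg hs]
      exact (mul_le_mul_of_nonneg_left (hM x) hs).trans hsM
    have h3 := (abs_le.1 (Real.exp_bound (n := 3) hb (by norm_num))).1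
    have h4 : |s * g x| ^ 3 ≤ (s * g x) ^ 2 := by
      rw [← sq_abs (s * g x)]
      exact pow_le_pow_of_le_one (abs_nonneg _) hb (by norm_num)
    simp only [Finset.sum_range_succ, Finset.sum_range_zero, Nat.factorial] at h3
    generalize |s * g x| ^ 3 = c at h3 h4
    norm_num at h3
    have h5 : 1 + s * g x + (s * g x) ^ 2 / 4 ≤ Real.exp (s * g x) := by
      nlinarith [sq_nonneg (s * g x)]
    nlinarith [mul_le_mul_of_nonneg_left h5 (hP x)]
  calc _ = ∑ x, (P x + s * (P x * g x) + s ^ 2 / 4 * (P x * g x ^ 2)) := by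
        rw [Finset.sum_add_distrib, Finset.sum_add_distrib, hP1, Finset.mul_sum, Finset.mul_sum]
    _ ≤ _ := Finset.sum_le_sum fun x _ => h1 x

lemma sum_prod_mul_exp (P g : X → ℝ) (s : ℝ) (n : ℕ) :
    ∑ x : Fin n → X, (∏ t, P (x t)) * Real.exp (s * ∑ t, g (x t))
      = (∑ a, P a * Real.exp (s * g a)) ^ n := by
  rw [Fintype.sum_pow]
  refine Finset.sum_congr rfl fun x _ => ?_
  rw [Finset.mul_sum, Real.exp_sum, Finset.prod_mul_distrib]

lemma sum_prod_eq_one {P : X → ℝ} (hP1 : ∑ x, P x = 1) (n : ℕ) :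
    ∑ x : Fin n → X, ∏ t, P (x t) = 1 := by
  rw [← Fintype.sum_pow, hP1, one_pow]

open Classical in
/-- Exponential form of the weak law of large numbers. -/
lemma exists_pow_tail_bound {P g : X → ℝ} (hP : ∀ x, 0 ≤ P x) (hP1 : ∑ x, P x = 1)
    (hg : ∑ x, P x * g x < 0) :
    ∃ r : ℝ, 0 ≤ r ∧ r < 1 ∧ ∀ n : ℕ,
      ∑ x : Fin n → X, (if 0 ≤ ∑ t, g (x t) then ∏ t, P (x t) else 0) ≤ r ^ n := by
  obtain ⟨M, hM1, hM⟩ := exists_abs_le_bound g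
  set μ : ℝ := -∑ x, P x * g x with hμ
  have hμ0 : 0 < μ := by linarith
  have hμM : μ ≤ M := by
    rw [hμ, ← Finset.sum_neg_distrib]
    calc ∑ x, -(P x * g x) ≤ ∑ x, P x * M := by
          refine Finset.sum_le_sum fun x _ => ?_
          rw [← mul_neg]
          exact mul_le_mul_of_nonneg_left ((neg_le_abs _).trans (hM x)) (hP x)
      _ = M := by rw [← Finset.sum_mul, hP1, one_mul]
  have hM0 : 0 < M := by linarith
  -- The minimizer of the quadratic bound 1 - sμ + s²M² on the moment generating function.
  set s : ℝ := μ / (2 * M ^ 2) with hs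
  have hs0 : 0 < s := by positivity
  have hsM : s * M ≤ 1 := by
    have : s * M = μ / (2 * M) := by rw [hs]; field_simp
    rw [this, div_le_one (by positivity)]
    linarith
  refine ⟨∑ a, P a * Real.exp (s * g a),
    Finset.sum_nonneg fun a _ => mul_nonneg (hP a) (Real.exp_pos _).le, ?_, fun n => ?_⟩
  · refine (mgf_le hP hP1 hM hs0.le hsM).trans_lt ?_
    have h2 : s * M ^ 2 = μ / 2 := by rw [hs]; field_simp
    have h3 : s ^ 2 * M ^ 2 = s * (μ / 2) := by rw [← h2]; ring
    have h4 : ∑ x, P x * g x = -μ := by rw [hμ, neg_neg]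
    rw [h3, h4]
    nlinarith [mul_pos hs0 hμ0]
  · rw [← sum_prod_mul_exp]
    refine Finset.sum_le_sum fun x _ => ?_
    have hp : 0 ≤ ∏ t, P (x t) := Finset.prod_nonneg fun t _ => hP _
    split_ifs with h
    · exact le_mul_of_one_le_right hp (Real.one_le_exp (mul_nonneg hs0.le h))
    · exact mul_nonneg hp (Real.exp_pos _).le

lemma tendsto_zero_of_le_pow {f : ℕ → ℝ} {r : ℝ} (hf : ∀ n, 0 ≤ f n) (hr : 0 ≤ r) (hr1 : r < 1)
    (h : ∀ n, f n ≤ r ^ n) : Tendsto f atTop (𝓝 0) :=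
  squeeze_zero hf h (tendsto_pow_atTop_nhds_zero_of_lt_one hr hr1)

open Classical in
/-- A non-degenerate centred random walk on the line is positive with probability bounded away
from zero along a subsequence. -/
lemma not_tendsto_prob_pos {P g : X → ℝ} (hP : ∀ x, 0 ≤ P x) (hP1 : ∑ x, P x = 1)
    (hg : ∑ x, P x * g x = 0) (hv : 0 < ∑ x, P x * g x ^ 2) :
    ¬ Tendsto (fun n : ℕ => ∑ x : Fin n → X, (if 0 < ∑ t, g (x t) then ∏ t, P (x t) else 0))
      atTop (𝓝 0) := by
  intro hT
  obtain ⟨M, hM1, hM⟩ := exists_abs_le_bound g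
  set v := ∑ x, P x * g x ^ 2 with hvdef
  -- `b` will bound E[exp(2θS)]. With ηb = v/8, the two error terms of `hmid` total less than v/4,
  -- the excess of E[exp(θS)] over 1.
  set b : ℝ := Real.exp (4 * M ^ 2) with hb
  have hb0 : 0 < b := Real.exp_pos _
  set η : ℝ := v / (8 * b) with hη
  have hη0 : 0 < η := by positivity
  have hev : ∀ᶠ n : ℕ in atTop,
      (∑ x : Fin n → X, (if 0 < ∑ t, g (x t) then ∏ t, P (x t) else 0)) < η * v / 8 :=
    hT.eventually (gt_mem_nhds (by positivity))
  obtain ⟨n, hn1, hn2⟩ := (hev.and (eventually_ge_atTop ⌈(2 * M) ^ 2⌉₊)).exists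
  have hn3 : (2 * M) ^ 2 ≤ (n : ℝ) := Nat.ceil_le.1 hn2
  have hM0 : 0 < M := by linarith
  have hn0 : (0 : ℝ) < n := lt_of_lt_of_le (by positivity) hn3
  -- Central limit scale: the linear term vanishes by centring and the quadratic one is of order 1/n
  -- per step, so the n-th powers stay between constants.
  set θ : ℝ := 1 / Real.sqrt n with hθ
  have hsq : 0 < Real.sqrt n := Real.sqrt_pos.2 hn0
  have hθ0 : 0 < θ := by positivity
  have hθ2 : θ ^ 2 = 1 / n := by rw [hθ, div_pow, Real.sq_sqrt hn0.le, one_pow]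
  have hθM : 2 * θ * M ≤ 1 := by
    have : 2 * M ≤ Real.sqrt n := Real.le_sqrt_of_sq_le hn3
    rw [hθ]
    calc 2 * (1 / Real.sqrt n) * M = (2 * M) / Real.sqrt n := by ring
      _ ≤ 1 := (div_le_one hsq).2 this
  have hlow : 1 + v / 4 ≤ (∑ a, P a * Real.exp (θ * g a)) ^ n := by
    have h1 := le_mgf hP hP1 hM hθ0.le (by nlinarith)
    rw [hg, mul_zero, add_zero, ← hvdef, hθ2] at h1
    have h2 : 1 + (n : ℝ) * (1 / n / 4 * v) ≤ (1 + 1 / n / 4 * v) ^ n :=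
      one_add_mul_le_pow (by
        have : (0 : ℝ) ≤ 1 / n / 4 * v := by positivity
        linarith) n
    have h3 : (n : ℝ) * (1 / n / 4 * v) = v / 4 := by field_simp
    rw [h3] at h2
    refine h2.trans (pow_le_pow_left₀ (by positivity) h1 n)
  have hup : (∑ a, P a * Real.exp (2 * θ * g a)) ^ n ≤ b := by
    have h1 := mgf_le hP hP1 hM (s := 2 * θ) (by positivity) hθM
    rw [hg, mul_zero, add_zero] at h1
    have h2 : (2 * θ) ^ 2 * M ^ 2 = 4 * M ^ 2 / n := by rw [mul_pow, hθ2]; ring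
    rw [h2] at h1
    have h3 : 1 + 4 * M ^ 2 / n ≤ Real.exp (4 * M ^ 2 / n) := by
      have := Real.add_one_le_exp (4 * M ^ 2 / n); linarith
    calc _ ≤ (Real.exp (4 * M ^ 2 / n)) ^ n :=
          pow_le_pow_left₀ (Finset.sum_nonneg fun a _ => mul_nonneg (hP a) (Real.exp_pos _).le)
            (h1.trans h3) n
      _ = b := by rw [← Real.exp_nat_mul, hb]; congr 1; field_simp
  rw [← sum_prod_mul_exp] at hlow hup
  -- Where S ≤ 0 the exponential is at most 1; where S > 0, the arithmetic-geometric mean inequality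
  -- gives 2u ≤ η⁻¹ + ηu² with u = exp(θS).
  have hmid : ∑ x : Fin n → X, (∏ t, P (x t)) * Real.exp (θ * ∑ t, g (x t))
      ≤ 1 + η⁻¹ * (∑ x : Fin n → X, (if 0 < ∑ t, g (x t) then ∏ t, P (x t) else 0))
        + η * ∑ x : Fin n → X, (∏ t, P (x t)) * Real.exp (2 * θ * ∑ t, g (x t)) := by
    rw [← sum_prod_eq_one hP1 n, Finset.mul_sum, Finset.mul_sum, ← Finset.sum_add_distrib,
      ← Finset.sum_add_distrib]
    refine Finset.sum_le_sum fun x _ => ?_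
    have hp : 0 ≤ ∏ t, P (x t) := Finset.prod_nonneg fun t _ => hP _
    set S := ∑ t, g (x t)
    have hE : Real.exp (2 * θ * S) = Real.exp (θ * S) ^ 2 := by
      rw [← Real.exp_nat_mul]; congr 1; push_cast; ring
    split_ifs with h
    · have : Real.exp (θ * S) ≤ 1 + η⁻¹ + η * Real.exp (2 * θ * S) := by
        rw [hE]
        have h0 : 0 ≤ η⁻¹ * (1 - η * Real.exp (θ * S)) ^ 2 := by positivity
        have h1 : η⁻¹ * (1 - η * Real.exp (θ * S)) ^ 2
          = η⁻¹ - 2 * Real.exp (θ * S) + η * Real.exp (θ * S) ^ 2 := by field_simp; ring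
        linarith [Real.exp_pos (θ * S)]
      nlinarith [mul_le_mul_of_nonneg_left this hp]
    · have h1 : Real.exp (θ * S) ≤ 1 :=
        Real.exp_le_one_iff.2 (mul_nonpos_of_nonneg_of_nonpos hθ0.le (not_lt.1 h))
      have h2 : 0 ≤ η * ((∏ t, P (x t)) * Real.exp (2 * θ * S)) := by positivity
      nlinarith [mul_le_mul_of_nonneg_left h1 hp]
  have h8 : η * b = v / 8 := by rw [hη]; field_simp
  have h9 : η⁻¹ * (η * v / 8) = v / 8 := by field_simp
  have h10 := mul_lt_mul_of_pos_left hn1 (by positivity : 0 < η⁻¹)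
  have h11 := mul_le_mul_of_nonneg_left hup hη0.le
  linarith

open Classical in
/-- If the walk is asymptotically almost surely nonpositive, then its drift is negative or its
steps vanish almost surely. -/
lemma drift_neg_or_eq_zero {P g : X → ℝ} (hP : ∀ x, 0 ≤ P x) (hP1 : ∑ x, P x = 1)
    (h : Tendsto (fun n : ℕ => ∑ x : Fin n → X, (if 0 < ∑ t, g (x t) then ∏ t, P (x t) else 0))
      atTop (𝓝 0)) :
    ∑ x, P x * g x < 0 ∨ ∀ x, P x ≠ 0 → g x = 0 := by
  by_contra! hcon
  obtain ⟨hge, x₀, hx₀, hgx₀⟩ := hcon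
  rcases hge.eq_or_lt with h0 | h0
  · refine not_tendsto_prob_pos hP hP1 h0.symm ?_ h
    refine Finset.sum_pos' (fun x _ => mul_nonneg (hP x) (sq_nonneg _)) ⟨x₀, Finset.mem_univ _, ?_⟩
    have := (hP x₀).lt_of_ne' hx₀
    positivity
  -- With positive drift, the tail bound for -g makes the nonpositive event vanish as well, although
  -- the two probabilities sum to 1.
  · obtain ⟨r, hr0, hr1, hr⟩ := exists_pow_tail_bound (g := fun x => -g x) hP hP1
      (by simpa using h0)
    have h2 := tendsto_zero_of_le_pow (fun n => Finset.sum_nonneg fun x _ => by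
      split_ifs
      · exact Finset.prod_nonneg fun t _ => hP _
      · exact le_rfl) hr0 hr1 hr
    have h3 := h.add h2
    rw [add_zero] at h3
    refine one_ne_zero (tendsto_nhds_unique ?_ h3)
    refine tendsto_const_nhds.congr fun n => ?_
    rw [← Finset.sum_add_distrib, ← sum_prod_eq_one hP1 n]
    refine Finset.sum_congr rfl fun x _ => ?_
    rw [Finset.sum_neg_distrib]
    by_cases hx : 0 < ∑ t, g (x t)
    · rw [if_pos hx, if_neg (by linarith), add_zero]
    · rw [if_neg hx, if_pos (by linarith), zero_add]

end FiniteSums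

/-! ### Convex duality for mutual information under a loss constraint -/

section Duality

open scoped Pointwise

variable {X Y : Type*} [Fintype X] [Fintype Y]

/-- The transition probabilities from `X` to `Y`. -/
def channels (X Y : Type*) [Fintype Y] : Set (X → Y → ℝ) :=
  {V | ∀ x, V x ∈ stdSimplex ℝ Y}

/-- The output law of the channel `V` with input law `P`. -/
noncomputable def outLaw (P : X → ℝ) (V : X → Y → ℝ) (y : Y) : ℝ := ∑ x, P x * V x y

/-- The expected loss under the input law `P` and the channel `V`. -/
noncomputable def avgLoss (P : X → ℝ) (d : X → Y → ℝ) (V : X → Y → ℝ) : ℝ :=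
  ∑ x, ∑ y, P x * (V x y * d x y)

/-- The mutual information, in nats, between the input and the output of the channel `V`. -/
noncomputable def mutInfo (P : X → ℝ) (V : X → Y → ℝ) : ℝ :=
  ∑ x, ∑ y, P x * (V x y * (Real.log (V x y) - Real.log (outLaw P V y)))

lemma isCompact_channels : IsCompact (channels X Y) := by
  have : channels X Y = Set.pi Set.univ fun _ => stdSimplex ℝ Y := by
    ext V; simp [channels]
  rw [this]
  exact isCompact_univ_pi fun _ => isCompact_stdSimplex ℝ Y

lemma convex_channels : Convex ℝ (channels X Y) := fun _ hV _ hW _ _ ha hb hab x =>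
  convex_stdSimplex ℝ Y (hV x) (hW x) ha hb hab

lemma outLaw_nonneg {P : X → ℝ} (hP : ∀ x, 0 ≤ P x) {V : X → Y → ℝ} (hV : V ∈ channels X Y)
    (y : Y) : 0 ≤ outLaw P V y :=
  Finset.sum_nonneg fun x _ => mul_nonneg (hP x) ((hV x).1 y)

lemma sum_outLaw {P : X → ℝ} (hP1 : ∑ x, P x = 1) {V : X → Y → ℝ} (hV : V ∈ channels X Y) :
    ∑ y, outLaw P V y = 1 := by
  unfold outLaw
  rw [Finset.sum_comm, ← hP1]
  refine Finset.sum_congr rfl fun x _ => ?_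
  rw [← Finset.mul_sum, (hV x).2, mul_one]

/-- Absolute continuity on the support of P; it keeps the convention `Real.log 0 = 0` harmless in
the entropy estimates. -/
lemma eq_zero_of_outLaw_eq_zero {P : X → ℝ} (hP : ∀ x, 0 ≤ P x) {V : X → Y → ℝ}
    (hV : V ∈ channels X Y) {x : X} {y : Y} (hx : P x ≠ 0) (h : outLaw P V y = 0) :
    V x y = 0 := by
  have := (Finset.sum_eq_zero_iff_of_nonneg
    (fun x _ => mul_nonneg (hP x) ((hV x).1 y))).1 h x (Finset.mem_univ x)
  exact (mul_eq_zero.1 this).resolve_left hx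

/-- Output entropy minus conditional entropy: in this form continuity is visible, since
`Real.negMulLog` is continuous at 0 although the logarithm is not. -/
lemma mutInfo_eq (P : X → ℝ) (V : X → Y → ℝ) :
    mutInfo P V = ∑ y, Real.negMulLog (outLaw P V y)
      - ∑ x, ∑ y, P x * Real.negMulLog (V x y) := by
  have : ∑ y, Real.negMulLog (outLaw P V y)
      = ∑ x, ∑ y, -(P x * (V x y * Real.log (outLaw P V y))) := by
    rw [Finset.sum_comm]
    refine Finset.sum_congr rfl fun y _ => ?_
    rw [Real.negMulLog, neg_mul, Finset.sum_neg_distrib]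
    conv_lhs => rw [outLaw, Finset.sum_mul]
    simp only [mul_assoc, outLaw]
  rw [this, ← Finset.sum_sub_distrib, mutInfo]
  refine Finset.sum_congr rfl fun x _ => ?_
  rw [← Finset.sum_sub_distrib]
  refine Finset.sum_congr rfl fun y _ => ?_
  rw [Real.negMulLog]
  ring

lemma continuous_mutInfo (P : X → ℝ) : Continuous fun V : X → Y → ℝ => mutInfo P V := by
  simp_rw [mutInfo_eq, outLaw]
  have h (x : X) (y : Y) : Continuous fun V : X → Y → ℝ => V x y := by fun_prop
  refine Continuous.sub ?_ ?_
  · refine continuous_finsetSum _ fun y _ => Real.continuous_negMulLog.comp ?_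
    exact continuous_finsetSum _ fun x _ => continuous_const.mul (h x y)
  · exact continuous_finsetSum _ fun x _ => continuous_finsetSum _ fun y _ =>
      continuous_const.mul (Real.continuous_negMulLog.comp (h x y))

lemma continuous_avgLoss (P : X → ℝ) (d : X → Y → ℝ) :
    Continuous fun V : X → Y → ℝ => avgLoss P d V := by
  unfold avgLoss
  fun_prop

lemma avgLoss_combo (P : X → ℝ) (d : X → Y → ℝ) (V W : X → Y → ℝ) (a b : ℝ) :
    avgLoss P d (a • V + b • W) = a * avgLoss P d V + b * avgLoss P d W := by
  simp only [avgLoss, Finset.mul_sum, ← Finset.sum_add_distrib]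
  refine Finset.sum_congr rfl fun x _ => Finset.sum_congr rfl fun y _ => ?_
  simp only [Pi.add_apply, Pi.smul_apply, smul_eq_mul]
  ring

lemma outLaw_combo (P : X → ℝ) (V W : X → Y → ℝ) (a b : ℝ) (y : Y) :
    outLaw P (a • V + b • W) y = a * outLaw P V y + b * outLaw P W y := by
  simp only [outLaw, Finset.mul_sum, ← Finset.sum_add_distrib]
  refine Finset.sum_congr rfl fun x _ => ?_
  simp only [Pi.add_apply, Pi.smul_apply, smul_eq_mul]
  ring

/-- The tangent inequality for the relative entropy integrand. -/
lemma entropy_tangent {a u c s : ℝ} (ha : 0 ≤ a) (hu : 0 ≤ u) (hau : u = 0 → a = 0) (hc : 0 < c)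
    (hs : 0 < s) :
    a * (Real.log c - Real.log s) + a - u * (c / s) ≤ a * (Real.log a - Real.log u) := by
  rcases ha.eq_or_lt with rfl | ha
  · simp only [zero_mul, add_zero, zero_sub, Left.neg_nonpos_iff]
    positivity
  · have hu' : 0 < u := hu.lt_of_ne fun h => ha.ne' (hau h.symm)
    have h1 := Real.log_le_sub_one_of_pos (show 0 < u * c / (s * a) by positivity)
    rw [Real.log_div (by positivity) (by positivity), Real.log_mul hu'.ne' hc.ne',
      Real.log_mul hs.ne' ha.ne'] at h1
    have h2 := mul_le_mul_of_nonneg_left h1 ha.le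
    have h3 : a * (u * c / (s * a) - 1) = u * (c / s) - a := by field_simp
    rw [h3] at h2
    linarith

/-- Two tangent inequalities at the common ratio (a + b)/(u + w) are added; their linear terms
cancel. -/
lemma log_sum_le {a b u w : ℝ} (ha : 0 ≤ a) (hb : 0 ≤ b) (hu : 0 ≤ u) (hw : 0 ≤ w)
    (hau : u = 0 → a = 0) (hbw : w = 0 → b = 0) :
    (a + b) * (Real.log (a + b) - Real.log (u + w))
      ≤ a * (Real.log a - Real.log u) + b * (Real.log b - Real.log w) := by
  rcases (add_nonneg ha hb).eq_or_lt with h | h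
  · have ha0 : a = 0 := by linarith
    have hb0 : b = 0 := by linarith
    simp [ha0, hb0]
  · have hs : 0 < u + w := by
      refine (add_nonneg hu hw).lt_of_ne fun h0 => h.ne' ?_
      rw [hau (by linarith), hbw (by linarith), add_zero]
    have h1 := entropy_tangent ha hu hau h hs
    have h2 := entropy_tangent hb hw hbw h hs
    have h3 : u * ((a + b) / (u + w)) + w * ((a + b) / (u + w)) = a + b := by field_simp
    linarith

lemma mul_log_sub_scale {a v u : ℝ} (h : u = 0 → v = 0) :
    a * v * (Real.log (a * v) - Real.log (a * u)) = a * (v * (Real.log v - Real.log u)) := by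
  by_cases ha : a = 0
  · simp [ha]
  by_cases hv : v = 0
  · simp [hv]
  rw [Real.log_mul ha hv, Real.log_mul ha fun hu => hv (h hu)]
  ring

/-- The log-sum inequality applied to each pair of letters. Letters outside the support of P are set
aside, because absolute continuity may fail there. -/
lemma mutInfo_combo_le {P : X → ℝ} (hP : ∀ x, 0 ≤ P x) {V W : X → Y → ℝ}
    (hV : V ∈ channels X Y) (hW : W ∈ channels X Y) {a b : ℝ} (ha : 0 ≤ a) (hb : 0 ≤ b) :
    mutInfo P (a • V + b • W) ≤ a * mutInfo P V + b * mutInfo P W := by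
  simp only [mutInfo, Finset.mul_sum, ← Finset.sum_add_distrib]
  refine Finset.sum_le_sum fun x _ => Finset.sum_le_sum fun y _ => ?_
  by_cases hx : P x = 0
  · simp [hx]
  have h1 : outLaw P V y = 0 → V x y = 0 := eq_zero_of_outLaw_eq_zero hP hV hx
  have h2 : outLaw P W y = 0 → W x y = 0 := eq_zero_of_outLaw_eq_zero hP hW hx
  rw [outLaw_combo]
  simp only [Pi.add_apply, Pi.smul_apply, smul_eq_mul]
  have h3 := log_sum_le (mul_nonneg ha ((hV x).1 y)) (mul_nonneg hb ((hW x).1 y))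
    (mul_nonneg ha (outLaw_nonneg hP hV y)) (mul_nonneg hb (outLaw_nonneg hP hW y))
    (fun h => (mul_eq_zero.1 h).elim (fun h => by rw [h, zero_mul]) fun h => by
      rw [h1 h, mul_zero])
    (fun h => (mul_eq_zero.1 h).elim (fun h => by rw [h, zero_mul]) fun h => by
      rw [h2 h, mul_zero])
  rw [mul_log_sub_scale h1, mul_log_sub_scale h2] at h3
  have := mul_le_mul_of_nonneg_left h3 (hP x)
  linarith

/-- If no channel of loss at most `D` has mutual information at most `ρ`, a Lagrange multiplier
certifies this. -/
lemma exists_lagrange {P : X → ℝ} (hP : ∀ x, 0 ≤ P x) (d : X → Y → ℝ) {D ρ : ℝ}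
    (hne : ∃ V ∈ channels X Y, avgLoss P d V ≤ D)
    (h : ∀ V ∈ channels X Y, avgLoss P d V ≤ D → ρ < mutInfo P V) :
    ∃ l : ℝ, 0 ≤ l ∧ ∀ V ∈ channels X Y, ρ + l * D < mutInfo P V + l * avgLoss P d V := by
  -- Upward closure of the achievable pairs (loss, information): closed as compact plus closed,
  -- convex by convexity of the information.
  set C : Set (ℝ × ℝ) := (fun V => (avgLoss P d V, mutInfo P V)) '' channels X Y
    + Set.Ici (0 : ℝ × ℝ) with hC
  have hmem : ∀ z : ℝ × ℝ, z ∈ C ↔ ∃ V ∈ channels X Y, avgLoss P d V ≤ z.1 ∧ mutInfo P V ≤ z.2 := by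
    intro z
    rw [hC, Set.mem_add]
    constructor
    · rintro ⟨_, ⟨V, hV, rfl⟩, w, hw, rfl⟩
      rw [Set.mem_Ici, Prod.le_def] at hw
      refine ⟨V, hV, ?_, ?_⟩
      · simpa using hw.1
      · simpa using hw.2
    · rintro ⟨V, hV, h1, h2⟩
      refine ⟨_, ⟨V, hV, rfl⟩, z - (avgLoss P d V, mutInfo P V), ?_, by simp⟩
      rw [Set.mem_Ici, Prod.le_def]
      simpa using ⟨h1, h2⟩
  have hcl : IsClosed C := isClosed_Ici.add_left_of_isCompact (isCompact_channels.image
    ((continuous_avgLoss P d).prodMk (continuous_mutInfo P)))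
  have hcv : Convex ℝ C := by
    intro z hz w hw a b ha hb hab
    obtain ⟨V, hV, hV1, hV2⟩ := (hmem z).1 hz
    obtain ⟨W, hW, hW1, hW2⟩ := (hmem w).1 hw
    refine (hmem _).2 ⟨a • V + b • W, convex_channels hV hW ha hb hab, ?_, ?_⟩
    · rw [avgLoss_combo]
      simp only [Prod.fst_add, Prod.smul_fst, smul_eq_mul]
      gcongr
    · refine (mutInfo_combo_le hP hV hW ha hb).trans ?_
      simp only [Prod.snd_add, Prod.smul_snd, smul_eq_mul]
      gcongr
  have hnot : (D, ρ) ∉ C := fun hz => by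
    obtain ⟨V, hV, h1, h2⟩ := (hmem _).1 hz
    exact (h V hV h1).not_ge h2
  obtain ⟨f, u, hfu, hf⟩ := geometric_hahn_banach_point_closed hcv hcl hnot
  set l := f (1, 0) with hl
  set μ := f (0, 1) with hμ
  have hfe : ∀ a b : ℝ, f (a, b) = l * a + μ * b := by
    intro a b
    have : ((a, b) : ℝ × ℝ) = a • (1, 0) + b • (0, 1) := by simp
    rw [this, map_add, map_smul, map_smul, smul_eq_mul, smul_eq_mul]
    ring
  obtain ⟨V₀, hV₀, hV₀D⟩ := hne
  -- An affine function bounded below on a ray has nonnegative slope; as `C` is upward closed, both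
  -- coefficients of `f` are nonnegative.
  have hcone : ∀ c e : ℝ, (∀ t : ℝ, 0 ≤ t → u < c + t * e) → 0 ≤ e := by
    intro c e hce
    by_contra! he
    have h1 := hce (max 0 ((c - u) / -e)) (le_max_left _ _)
    have h2 := mul_le_mul_of_nonneg_right (le_max_right 0 ((c - u) / -e)) (neg_nonneg.2 he.le)
    rw [div_mul_cancel₀ _ (by linarith)] at h2
    linarith
  have hl0 : 0 ≤ l := hcone (f (D, mutInfo P V₀)) l fun t ht => by
    have := hf (D + t, mutInfo P V₀) ((hmem _).2 ⟨V₀, hV₀, by dsimp only; linarith, le_rfl⟩)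
    rw [hfe] at this ⊢
    linarith
  have hμ0 : 0 ≤ μ := hcone (f (D, mutInfo P V₀)) μ fun t ht => by
    have := hf (D, mutInfo P V₀ + t) ((hmem _).2 ⟨V₀, hV₀, hV₀D, by dsimp only; linarith⟩)
    rw [hfe] at this ⊢
    linarith
  -- The separation is strict, so one feasible channel excludes a vertical line; no Slater point of
  -- loss strictly below D is needed.
  have hμ1 : 0 < μ := by
    refine hμ0.lt_of_ne fun h0 => ?_
    have := hfu.trans (hf (D, mutInfo P V₀) ((hmem _).2 ⟨V₀, hV₀, hV₀D, le_rfl⟩))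
    rw [hfe, hfe, ← h0] at this
    linarith
  refine ⟨l / μ, by positivity, fun V hV => ?_⟩
  have := hfu.trans (hf _ ((hmem (avgLoss P d V, mutInfo P V)).2 ⟨V, hV, le_rfl, le_rfl⟩))
  rw [hfe, hfe] at this
  have h2 := div_lt_div_of_pos_right this hμ1
  have h3 : ∀ a b : ℝ, (l * a + μ * b) / μ = b + l / μ * a := fun a b => by field_simp; ring
  rwa [h3, h3] at h2

/-- Gibbs' inequality: the output law minimizes the relative entropy. -/
lemma mutInfo_le {P : X → ℝ} (hP : ∀ x, 0 ≤ P x) (hP1 : ∑ x, P x = 1) {V : X → Y → ℝ}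
    (hV : V ∈ channels X Y) {q : Y → ℝ} (hq : q ∈ stdSimplex ℝ Y)
    (hqV : ∀ x y, q y = 0 → V x y = 0) :
    mutInfo P V ≤ ∑ x, ∑ y, P x * (V x y * (Real.log (V x y) - Real.log (q y))) := by
  have h1 : ∀ y, outLaw P V y - q y
      ≤ outLaw P V y * (Real.log (outLaw P V y) - Real.log (q y)) := fun y => by
    have := entropy_tangent (outLaw_nonneg hP hV y) (hq.1 y)
      (fun h => Finset.sum_eq_zero fun x _ => by rw [hqV x y h, mul_zero]) one_pos one_pos
    simpa using this
  have h2 := Finset.sum_le_sum fun y (_ : y ∈ Finset.univ) => h1 y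
  rw [Finset.sum_sub_distrib, sum_outLaw hP1 hV, hq.2, sub_self] at h2
  have h3 : ∑ y, outLaw P V y * (Real.log (outLaw P V y) - Real.log (q y))
      = ∑ x, ∑ y, P x * (V x y * (Real.log (outLaw P V y) - Real.log (q y))) := by
    rw [Finset.sum_comm]
    refine Finset.sum_congr rfl fun y _ => ?_
    conv_lhs => rw [outLaw, Finset.sum_mul]
    simp only [mul_assoc, outLaw]
  rw [h3] at h2
  rw [mutInfo, ← sub_nonneg, ← Finset.sum_sub_distrib]
  refine h2.trans (le_of_eq ?_)
  refine Finset.sum_congr rfl fun x _ => ?_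
  rw [← Finset.sum_sub_distrib]
  refine Finset.sum_congr rfl fun y _ => ?_
  ring

/-- First-order optimality conditions for the maximization of `∑ P log ∑ q k` over laws `q`. -/
lemma exists_optimal_law [Nonempty Y] {P : X → ℝ} (hP : ∀ x, 0 ≤ P x) (hP1 : ∑ x, P x = 1)
    {k : X → Y → ℝ} (hk : ∀ x y, 0 < k x y) :
    ∃ q ∈ stdSimplex ℝ Y, (∀ x, 0 < ∑ y, q y * k x y) ∧
      ∀ y, ∑ x, P x * (k x y / ∑ z, q z * k x z) ≤ 1 := by
  classical
  have hpos : ∀ q ∈ stdSimplex ℝ Y, ∀ x, 0 < ∑ y, q y * k x y := by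
    intro q hq x
    obtain ⟨y, hy⟩ : ∃ y, q y ≠ 0 := by
      by_contra! h
      have := hq.2
      simp [h] at this
    refine Finset.sum_pos' (fun y _ => mul_nonneg (hq.1 y) (hk x y).le) ⟨y, Finset.mem_univ y, ?_⟩
    exact mul_pos ((hq.1 y).lt_of_ne' hy) (hk x y)
  obtain ⟨q, hq, hmax⟩ := (isCompact_stdSimplex ℝ Y).exists_isMaxOn
    (f := fun q => ∑ x, P x * Real.log (∑ y, q y * k x y))
    ⟨_, single_mem_stdSimplex ℝ (Classical.arbitrary Y)⟩ (by
      refine continuousOn_finsetSum _ fun x _ => continuousOn_const.mul ?_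
      refine ContinuousOn.log (by fun_prop) fun q hq => (hpos q hq x).ne')
  refine ⟨q, hq, hpos q hq, fun y => ?_⟩
  set S : X → ℝ := fun x => ∑ z, q z * k x z with hS
  have hS0 : ∀ x, 0 < S x := hpos q hq
  -- Derivative of log S as q moves toward the point mass at y; its mean must not be positive at a
  -- maximum.
  set c : X → ℝ := fun x => k x y / S x - 1 with hc
  have hc1 : ∀ x, -1 < c x := fun x => by
    have := div_pos (hk x y) (hS0 x)
    simp only [hc]; linarith
  have hsum : ∑ x, P x * c x = ∑ x, P x * (k x y / S x) - 1 := by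
    simp only [hc, mul_sub, mul_one, Finset.sum_sub_distrib, hP1]
  suffices ∑ x, P x * c x ≤ 0 by
    rw [hsum] at this
    linarith
  obtain ⟨M, hM1, hM⟩ := exists_abs_le_bound c
  by_contra! hΔ
  set Δ := ∑ x, P x * c x with hΔdef
  have hΔM : Δ ≤ M := by
    calc Δ ≤ ∑ x, P x * M := Finset.sum_le_sum fun x _ =>
          mul_le_mul_of_nonneg_left ((le_abs_self _).trans (hM x)) (hP x)
      _ = M := by rw [← Finset.sum_mul, hP1, one_mul]
  have hM0 : 0 < M := by linarith
  -- This step makes the second-order loss 2ε²M² half of the first-order gain εΔ.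
  set ε := Δ / (4 * M ^ 2) with hε
  have hε0 : 0 < ε := by positivity
  have hε1 : ε ≤ 1 / 4 := by
    rw [hε, div_le_div_iff₀ (by positivity) (by norm_num)]
    nlinarith
  have hqε : ((1 - ε) • q + ε • Pi.single y (1 : ℝ) : Y → ℝ) ∈ stdSimplex ℝ Y :=
    convex_stdSimplex ℝ Y hq (single_mem_stdSimplex ℝ y) (by linarith) hε0.le (by ring)
  have hval := hmax hqε
  simp only [Set.mem_ofPred_eq] at hval
  have hSε : ∀ x, ∑ z, ((1 - ε) • q + ε • Pi.single y (1 : ℝ) : Y → ℝ) z * k x z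
      = S x * (1 + ε * c x) := by
    intro x
    have h1 : S x * c x = k x y - S x := by
      have := (hS0 x).ne'
      simp only [hc]; field_simp
    simp only [Pi.add_apply, Pi.smul_apply, smul_eq_mul, add_mul, Finset.sum_add_distrib,
      mul_assoc, ← Finset.mul_sum, Pi.single_apply, ite_mul, one_mul, zero_mul,
      Finset.sum_ite_eq', Finset.mem_univ, if_true]
    change (1 - ε) * S x + ε * k x y = _
    linear_combination (-ε) * h1
  -- Uses log(1 + u) ≥ u - 2u² for u > -1/2, a consequence of log z ≥ 1 - 1/z.
  have hlog : ∀ x, Real.log (S x) + (ε * c x - 2 * ε ^ 2 * c x ^ 2)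
      ≤ Real.log (∑ z, ((1 - ε) • q + ε • Pi.single y (1 : ℝ) : Y → ℝ) z * k x z) := by
    intro x
    have hp : 1 / 2 < 1 + ε * c x := by nlinarith [hc1 x]
    rw [hSε, Real.log_mul (hS0 x).ne' (by linarith)]
    have h1 := Real.one_sub_inv_le_log_of_pos (show 0 < 1 + ε * c x by linarith)
    have h2 : 1 - (1 + ε * c x)⁻¹ - (ε * c x - 2 * ε ^ 2 * c x ^ 2)
        = (ε * c x) ^ 2 * (2 * (1 + ε * c x) - 1) / (1 + ε * c x) := by
      field_simp; ring
    have h3 : 0 ≤ (ε * c x) ^ 2 * (2 * (1 + ε * c x) - 1) / (1 + ε * c x) :=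
      div_nonneg (mul_nonneg (sq_nonneg _) (by linarith)) (by linarith)
    linarith
  have hge := Finset.sum_le_sum fun x (_ : x ∈ Finset.univ) =>
    mul_le_mul_of_nonneg_left (hlog x) (hP x)
  have heq : ∑ x, P x * (Real.log (S x) + (ε * c x - 2 * ε ^ 2 * c x ^ 2))
      = ∑ x, P x * Real.log (S x) + ε * Δ - 2 * ε ^ 2 * ∑ x, P x * c x ^ 2 := by
    rw [hΔdef, Finset.mul_sum, Finset.mul_sum, ← Finset.sum_add_distrib,
      ← Finset.sum_sub_distrib]
    exact Finset.sum_congr rfl fun x _ => by ring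
  rw [heq] at hge
  have hfin : ε * Δ ≤ 2 * ε ^ 2 * M ^ 2 := by
    have := mul_le_mul_of_nonneg_left (weighted_sq_le hP hP1 hM)
      (by positivity : 0 ≤ 2 * ε ^ 2)
    have h5 : ∑ x, P x * Real.log (∑ z, q z * k x z) = ∑ x, P x * Real.log (S x) := rfl
    linarith
  have h6 : ε * M ^ 2 = Δ / 4 := by rw [hε]; field_simp
  have h7 : 2 * ε ^ 2 * M ^ 2 = ε * (Δ / 2) := by
    have : 2 * ε ^ 2 * M ^ 2 = 2 * ε * (ε * M ^ 2) := by ring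
    rw [this, h6]; ring
  rw [h7] at hfin
  nlinarith [mul_pos hε0 hΔ]

/-- The dual certificate for the Lagrangian of the rate-distortion problem. -/
lemma exists_dual_certificate [Nonempty Y] {P : X → ℝ} (hP : ∀ x, 0 ≤ P x)
    (hP1 : ∑ x, P x = 1) (d : X → Y → ℝ) (l : ℝ) :
    ∃ α : X → ℝ, (∀ x, 0 < α x) ∧ (∀ y, ∑ x, P x * (α x * Real.exp (-l * d x y)) ≤ 1) ∧
      ∃ V ∈ channels X Y, mutInfo P V + l * avgLoss P d V ≤ ∑ x, P x * Real.log (α x) := by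
  obtain ⟨q, hq, hS, hopt⟩ := exists_optimal_law hP hP1
    (k := fun x y => Real.exp (-l * d x y)) fun x y => Real.exp_pos _
  set S : X → ℝ := fun x => ∑ y, q y * Real.exp (-l * d x y) with hSdef
  have hS0 : ∀ x, 0 < S x := hS
  -- α is the reciprocal partition function, so the optimality conditions become the dual
  -- constraints. The channel q exp(-ld)/S has relative entropy to q plus l times loss exactly equal
  -- to the dual value, and Gibbs' inequality compares this with its mutual information.
  refine ⟨fun x => (S x)⁻¹, fun x => inv_pos.2 (hS0 x), fun y => ?_, ?_⟩
  · refine le_trans (le_of_eq ?_) (hopt y)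
    exact Finset.sum_congr rfl fun x _ => by rw [div_eq_mul_inv, mul_comm (S x)⁻¹]
  · have hV : (fun x y => q y * Real.exp (-l * d x y) * (S x)⁻¹) ∈ channels X Y := by
      refine fun x => ⟨fun y => ?_, ?_⟩
      · exact mul_nonneg (mul_nonneg (hq.1 y) (Real.exp_pos _).le) (inv_pos.2 (hS0 x)).le
      · rw [← Finset.sum_mul]
        exact mul_inv_cancel₀ (hS0 x).ne'
    refine ⟨_, hV, ?_⟩
    have h1 := mutInfo_le hP hP1 hV hq fun x y h => by simp [h]
    refine (add_le_add_left h1 _).trans (le_of_eq ?_)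
    rw [avgLoss, Finset.mul_sum, ← Finset.sum_add_distrib]
    refine Finset.sum_congr rfl fun x _ => ?_
    rw [Finset.mul_sum, ← Finset.sum_add_distrib]
    have hterm : ∀ y, P x * (q y * Real.exp (-l * d x y) * (S x)⁻¹ *
          (Real.log (q y * Real.exp (-l * d x y) * (S x)⁻¹) - Real.log (q y)))
        + l * (P x * (q y * Real.exp (-l * d x y) * (S x)⁻¹ * d x y))
        = q y * Real.exp (-l * d x y) * (S x)⁻¹ * (P x * Real.log (S x)⁻¹) := by
      intro y
      by_cases hy : q y = 0
      · simp [hy]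
      rw [Real.log_mul (mul_ne_zero hy (Real.exp_pos _).ne') (inv_ne_zero (hS0 x).ne'),
        Real.log_mul hy (Real.exp_pos _).ne', Real.log_exp]
      ring
    rw [Finset.sum_congr rfl fun y _ => hterm y, ← Finset.sum_mul, (hV x).2, one_mul]

open Classical in
/-- The packing bound implied by a dual certificate. -/
lemma packing_bound {P : X → ℝ} (hP : ∀ x, 0 ≤ P x) {d : X → Y → ℝ} {α : X → ℝ}
    (hα : ∀ x, 0 < α x) {l D ρ : ℝ} (hl : 0 ≤ l)
    (hcert : ∀ y, ∑ x, P x * (α x * Real.exp (-l * d x y)) ≤ 1) {n : ℕ} (y : Fin n → Y) :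
    ∑ x : Fin n → X, (if (n * (ρ + l * D) < ∑ t, Real.log (α (x t)) ∧
        ∑ t, d (x t) (y t) ≤ n * D) then ∏ t, P (x t) else 0) ≤ Real.exp (-(n * ρ)) := by
  -- Markov's inequality pointwise: on the event the product of α exp(-ld) is at least exp(nρ), and
  -- its expectation factorizes over letters.
  have h1 : ∀ x : Fin n → X, (if (n * (ρ + l * D) < ∑ t, Real.log (α (x t)) ∧
        ∑ t, d (x t) (y t) ≤ n * D) then ∏ t, P (x t) else 0)
      ≤ Real.exp (-(n * ρ)) * ∏ t, (P (x t) * (α (x t) * Real.exp (-l * d (x t) (y t)))) := by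
    intro x
    have hp : 0 ≤ ∏ t, P (x t) := Finset.prod_nonneg fun t _ => hP _
    split_ifs with h
    · have h2 : ∏ t, (α (x t) * Real.exp (-l * d (x t) (y t)))
          = Real.exp (∑ t, Real.log (α (x t)) - l * ∑ t, d (x t) (y t)) := by
        rw [sub_eq_add_neg, ← neg_mul, Finset.mul_sum, ← Finset.sum_add_distrib, Real.exp_sum]
        refine Finset.prod_congr rfl fun t _ => ?_
        rw [Real.exp_add, Real.exp_log (hα _)]
      rw [Finset.prod_mul_distrib, h2, mul_left_comm, ← Real.exp_add]
      refine le_mul_of_one_le_right hp (Real.one_le_exp ?_)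
      nlinarith [mul_le_mul_of_nonneg_left h.2 hl]
    · exact mul_nonneg (Real.exp_pos _).le (Finset.prod_nonneg fun t _ =>
        mul_nonneg (hP _) (mul_nonneg (hα _).le (Real.exp_pos _).le))
  refine (Finset.sum_le_sum fun x _ => h1 x).trans ?_
  rw [← Finset.mul_sum, sum_pi_prod fun t a => P a * (α a * Real.exp (-l * d a (y t)))]
  refine mul_le_of_le_one_right (Real.exp_pos _).le (Finset.prod_le_one (fun t _ => ?_) fun t _ =>
    hcert _)
  exact Finset.sum_nonneg fun a _ => mul_nonneg (hP _) (mul_nonneg (hα _).le (Real.exp_pos _).le)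

end Duality

/-! ### Random covering and the memoryless channel -/

section Covering

variable {X Y : Type*} [Fintype X] [Fintype Y]

open Classical in
/-- Random covering: some codebook leaves uncovered at most the average uncovered mass. -/
lemma exists_codebook {w : X → ℝ} {q : Y → ℝ} (hq : ∀ y, 0 ≤ q y)
    (hq1 : ∑ y, q y = 1) (good : X → Y → Prop) (K : ℕ) :
    ∃ c : Fin K → Y, ∑ x, (if ∃ k, good x (c k) then 0 else w x)
      ≤ ∑ x, w x * (1 - ∑ y, if good x y then q y else 0) ^ K := by
  have hone : ∑ c : Fin K → Y, ∏ k, q (c k) = 1 := sum_prod_eq_one hq1 K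
  have havg : ∑ c : Fin K → Y, (∏ k, q (c k)) * ∑ x, (if ∃ k, good x (c k) then 0 else w x)
      = ∑ x, w x * (1 - ∑ y, if good x y then q y else 0) ^ K := by
    simp_rw [Finset.mul_sum]
    rw [Finset.sum_comm]
    refine Finset.sum_congr rfl fun x _ => ?_
    have h1 : 1 - (∑ y, if good x y then q y else 0) = ∑ y, if good x y then 0 else q y := by
      rw [← hq1, ← Finset.sum_sub_distrib]
      exact Finset.sum_congr rfl fun y _ => by split_ifs <;> simp
    rw [h1, Fintype.sum_pow, Finset.mul_sum]
    refine Finset.sum_congr rfl fun c _ => ?_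
    split_ifs with h
    · obtain ⟨k, hk⟩ := h
      have hz : ∏ k, (if good x (c k) then 0 else q (c k)) = 0 :=
        Finset.prod_eq_zero (Finset.mem_univ k) (if_pos hk)
      rw [hz, mul_zero, mul_zero]
    · push Not at h
      rw [mul_comm]
      congr 1
      exact Finset.prod_congr rfl fun k _ => (if_neg (h k)).symm
  by_contra! hcon
  set b := ∑ x, w x * (1 - ∑ y, if good x y then q y else 0) ^ K
  have hne : ∃ c : Fin K → Y, ∏ k, q (c k) ≠ 0 := by
    by_contra! h0
    simp [h0] at hone
  obtain ⟨c₀, hc₀⟩ := hne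
  have hlt : ∑ c : Fin K → Y, (∏ k, q (c k)) * b
      < ∑ c : Fin K → Y, (∏ k, q (c k)) * ∑ x, (if ∃ k, good x (c k) then 0 else w x) := by
    refine Finset.sum_lt_sum (fun c _ => mul_le_mul_of_nonneg_left (hcon c).le
      (Finset.prod_nonneg fun k _ => hq _)) ⟨c₀, Finset.mem_univ _, ?_⟩
    exact mul_lt_mul_of_pos_left (hcon c₀)
      ((Finset.prod_nonneg fun k _ => hq _).lt_of_ne' hc₀)
  rw [← Finset.sum_mul, hone, one_mul, havg] at hlt
  exact lt_irrefl _ hlt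

/-- The chord of the exponential over [-Kc, 0] bounds exp(-Kcv). This separates the atypical mass 1
- v from a term that vanishes once Kc is large. -/
lemma one_sub_pow_le {Q c v : ℝ} {K : ℕ} (hv : 0 ≤ v) (hv1 : v ≤ 1) (hQ : c * v ≤ Q)
    (hQ1 : Q ≤ 1) : (1 - Q) ^ K ≤ 1 - v + Real.exp (-(K * c)) := by
  have h1 : (1 - Q) ^ K ≤ Real.exp (-(K * c) * v) := by
    calc (1 - Q) ^ K ≤ Real.exp (-Q) ^ K :=
          pow_le_pow_left₀ (by linarith) (Real.one_sub_le_exp_neg Q) K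
      _ = Real.exp (K * -Q) := (Real.exp_nat_mul _ _).symm
      _ ≤ _ := by
        refine Real.exp_le_exp.2 ?_
        nlinarith [mul_le_mul_of_nonneg_left hQ (Nat.cast_nonneg (α := ℝ) K)]
  have h2 := convexOn_exp.2 (Set.mem_univ 0) (Set.mem_univ (-(K * c))) (sub_nonneg.2 hv1) hv
    (by ring)
  simp only [smul_eq_mul, mul_zero, zero_add, Real.exp_zero, mul_one] at h2
  have h3 : v * Real.exp (-(K * c)) ≤ Real.exp (-(K * c)) :=
    mul_le_of_le_one_left (Real.exp_pos _).le hv1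
  rw [mul_comm] at h1
  linarith

lemma sum_pairs {n : ℕ} (F : (Fin n → X) → (Fin n → Y) → ℝ) :
    ∑ z : Fin n → X × Y, F (fun t => (z t).1) (fun t => (z t).2) = ∑ x, ∑ y, F x y := by
  rw [← Fintype.sum_prod_type']
  exact Fintype.sum_equiv (Equiv.arrowProdEquivProdArrow (Fin n) (fun _ => X) (fun _ => Y)) _ _
    fun z => rfl

open Classical in
/-- One-shot rate-distortion achievability. -/
lemma exists_codebook_of_channel {P : X → ℝ} (hP : ∀ x, 0 ≤ P x) (hP1 : ∑ x, P x = 1)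
    {V : X → Y → ℝ} (hV : V ∈ channels X Y) (d : X → Y → ℝ) (D ρ : ℝ) (n K : ℕ) :
    ∃ c : Fin K → Fin n → Y,
      ∑ x : Fin n → X, (if ∃ k, ∑ t, d (x t) (c k t) ≤ n * D then 0 else ∏ t, P (x t)) ≤
        ∑ x : Fin n → X, ∑ y : Fin n → Y,
          (if n * D < ∑ t, d (x t) (y t) then ∏ t, P (x t) * V (x t) (y t) else 0) +
        ∑ x : Fin n → X, ∑ y : Fin n → Y,
          (if n * ρ ≤ ∑ t, (Real.log (V (x t) (y t)) - Real.log (outLaw P V (y t)))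
            then ∏ t, P (x t) * V (x t) (y t) else 0) +
        Real.exp (-(K * Real.exp (-(n * ρ)))) := by
  set q := outLaw P V with hq
  have hq0 : ∀ y, 0 ≤ q y := outLaw_nonneg hP hV
  have hq1 : ∑ y, q y = 1 := sum_outLaw hP1 hV
  set near : (Fin n → X) → (Fin n → Y) → Prop := fun x y => ∑ t, d (x t) (y t) ≤ n * D with hnear
  set typ : (Fin n → X) → (Fin n → Y) → Prop := fun x y =>
    ∑ t, (Real.log (V (x t) (y t)) - Real.log (q (y t))) < n * ρ with htyp
  -- Conditional probability that the channel output is within distortion and has information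
  -- density below nρ.
  set v : (Fin n → X) → ℝ := fun x => ∑ y : Fin n → Y,
    if near x y ∧ typ x y then ∏ t, V (x t) (y t) else 0 with hv
  have hVn : ∀ (x : Fin n → X) (y : Fin n → Y), 0 ≤ ∏ t, V (x t) (y t) := fun x y =>
    Finset.prod_nonneg fun t _ => (hV _).1 _
  have hVn1 : ∀ x : Fin n → X, ∑ y : Fin n → Y, ∏ t, V (x t) (y t) = 1 := fun x => by
    rw [sum_pi_prod fun t b => V (x t) b]
    exact Finset.prod_eq_one fun t _ => (hV _).2
  have hv0 : ∀ x, 0 ≤ v x := fun x => Finset.sum_nonneg fun y _ => by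
    split_ifs
    exacts [hVn x y, le_rfl]
  have hv1 : ∀ x, v x ≤ 1 := fun x => by
    rw [← hVn1 x]
    refine Finset.sum_le_sum fun y _ => ?_
    split_ifs
    exacts [le_rfl, hVn x y]
  have hqn : ∀ y : Fin n → Y, 0 ≤ ∏ t, q (y t) := fun y => Finset.prod_nonneg fun t _ => hq0 _
  obtain ⟨c, hc⟩ := exists_codebook (w := fun x : Fin n → X => ∏ t, P (x t)) hqn
    (sum_prod_eq_one hq1 n) near K
  refine ⟨c, hc.trans ?_⟩
  have hkey : ∀ x : Fin n → X, (∏ t, P (x t)) *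
      (1 - ∑ y : Fin n → Y, if near x y then ∏ t, q (y t) else 0) ^ K
      ≤ (∏ t, P (x t)) * (1 - v x) + (∏ t, P (x t)) * Real.exp (-(K * Real.exp (-(n * ρ)))) := by
    intro x
    -- Source words of probability zero are dropped: `V` need not be dominated by `q` there.
    by_cases hx : ∃ t, P (x t) = 0
    · obtain ⟨t, ht⟩ := hx
      rw [Finset.prod_eq_zero (Finset.mem_univ t) ht]
      simp
    push Not at hx
    rw [← mul_add]
    refine mul_le_mul_of_nonneg_left (one_sub_pow_le (hv0 x) (hv1 x) ?_ ?_)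
      (Finset.prod_nonneg fun t _ => hP _)
    · rw [hv, Finset.mul_sum]
      refine Finset.sum_le_sum fun y _ => ?_
      by_cases h1 : near x y
      · rw [if_pos h1]
        by_cases h2 : typ x y
        · rw [if_pos ⟨h1, h2⟩]
          -- Change of measure: on typical pairs the channel law exceeds the output law by a factor
          -- of at most exp(nρ).
          have h3 : ∏ t, V (x t) (y t) ≤ (∏ t, q (y t)) * Real.exp (n * ρ) := by
            calc ∏ t, V (x t) (y t)
                ≤ ∏ t, (q (y t) *
                  Real.exp (Real.log (V (x t) (y t)) - Real.log (q (y t)))) := by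
                  refine Finset.prod_le_prod (fun t _ => (hV _).1 _) fun t _ => ?_
                  rcases ((hV (x t)).1 (y t)).eq_or_lt with h0 | h0
                  · rw [← h0]
                    exact mul_nonneg (hq0 _) (Real.exp_pos _).le
                  · have hqp : 0 < q (y t) := (hq0 _).lt_of_ne' fun h =>
                      h0.ne' (eq_zero_of_outLaw_eq_zero hP hV (hx t) h)
                    rw [Real.exp_sub, Real.exp_log h0, Real.exp_log hqp,
                      mul_div_cancel₀ _ hqp.ne']
              _ = (∏ t, q (y t)) *
                  Real.exp (∑ t, (Real.log (V (x t) (y t)) - Real.log (q (y t)))) := by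
                  rw [Finset.prod_mul_distrib, Real.exp_sum]
              _ ≤ _ := mul_le_mul_of_nonneg_left (Real.exp_le_exp.2 h2.le) (hqn y)
          rw [Real.exp_neg, inv_mul_le_iff₀ (Real.exp_pos _), mul_comm (Real.exp _)]
          exact h3
        · rw [if_neg fun h => h2 h.2, mul_zero]
          exact hqn y
      · rw [if_neg h1, if_neg fun h => h1 h.1, mul_zero]
    · rw [← sum_prod_eq_one hq1 n]
      refine Finset.sum_le_sum fun y _ => ?_
      split_ifs
      exacts [le_rfl, hqn y]
  refine (Finset.sum_le_sum fun x _ => hkey x).trans ?_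
  rw [Finset.sum_add_distrib, ← Finset.sum_mul, sum_prod_eq_one hP1 n, one_mul]
  refine add_le_add_left ?_ _
  rw [← Finset.sum_add_distrib]
  refine Finset.sum_le_sum fun x _ => ?_
  rw [← Finset.sum_add_distrib, ← hVn1 x, hv, ← Finset.sum_sub_distrib, Finset.mul_sum]
  refine Finset.sum_le_sum fun y _ => ?_
  have h0 : 0 ≤ ∏ t, P (x t) * V (x t) (y t) :=
    Finset.prod_nonneg fun t _ => mul_nonneg (hP _) ((hV _).1 _)
  by_cases h1 : near x y
  · by_cases h2 : typ x y
    · rw [if_pos ⟨h1, h2⟩, sub_self, mul_zero]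
      split_ifs <;> simp [h0]
    · rw [if_neg fun h => h2 h.2, sub_zero, if_pos (not_lt.1 h2), ← Finset.prod_mul_distrib]
      split_ifs <;> simp [h0]
  · rw [if_neg fun h => h1 h.1, sub_zero, if_pos (not_le.1 h1), ← Finset.prod_mul_distrib]
    split_ifs <;> simp [h0]

open Classical in
/-- The empirical mean of `f` over the memoryless channel is asymptotically below any level that
exceeds the expectation of `f`. -/
lemma tendsto_empiricalMean_tail {P : X → ℝ} (hP : ∀ x, 0 ≤ P x) (hP1 : ∑ x, P x = 1)
    {V : X → Y → ℝ} (hV : V ∈ channels X Y) {f : X → Y → ℝ} {ρ : ℝ}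
    (hρ : ∑ x, ∑ y, P x * (V x y * f x y) < ρ) :
    Tendsto (fun n : ℕ => ∑ x : Fin n → X, ∑ y : Fin n → Y,
      (if n * ρ ≤ ∑ t, f (x t) (y t) then ∏ t, P (x t) * V (x t) (y t) else 0)) atTop (𝓝 0) := by
  have hW0 : ∀ z : X × Y, 0 ≤ P z.1 * V z.1 z.2 := fun z => mul_nonneg (hP _) ((hV _).1 _)
  have hW1 : ∑ z : X × Y, P z.1 * V z.1 z.2 = 1 := by
    rw [Fintype.sum_prod_type, ← hP1]
    refine Finset.sum_congr rfl fun x _ => ?_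
    dsimp only
    rw [← Finset.mul_sum, (hV x).2, mul_one]
  have hg : ∑ z : X × Y, P z.1 * V z.1 z.2 * (f z.1 z.2 - ρ) < 0 := by
    have : ∑ z : X × Y, P z.1 * V z.1 z.2 * (f z.1 z.2 - ρ)
        = ∑ x, ∑ y, P x * (V x y * f x y) - ρ := by
      simp_rw [mul_sub]
      rw [Finset.sum_sub_distrib, ← Finset.sum_mul, hW1, one_mul, Fintype.sum_prod_type]
      simp_rw [mul_assoc]
    linarith
  obtain ⟨r, hr0, hr1, hr⟩ := exists_pow_tail_bound hW0 hW1 hg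
  refine tendsto_zero_of_le_pow (fun n => ?_) hr0 hr1 fun n => ?_
  · refine Finset.sum_nonneg fun x _ => Finset.sum_nonneg fun y _ => ?_
    split_ifs
    · exact Finset.prod_nonneg fun t _ => mul_nonneg (hP _) ((hV _).1 _)
    · exact le_rfl
  · refine le_trans (le_of_eq ?_) (hr n)
    rw [← sum_pairs]
    refine Finset.sum_congr rfl fun z _ => ?_
    simp only [Finset.sum_sub_distrib, Finset.sum_const, Finset.card_univ, Fintype.card_fin,
      nsmul_eq_mul, sub_nonneg]

end Covering

/-! ### Achievability and packing for the operational rate-distortion function -/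

namespace Unicast

lemma iid_toOuterMeasure {X : Type*} [Fintype X] (p : PMF X) (n : ℕ) (S : Set (Fin n → X))
    [DecidablePred (· ∈ S)] :
    (iid p n).toOuterMeasure S
      = ENNReal.ofReal (∑ x, if x ∈ S then ∏ t, (p (x t)).toReal else 0) := by
  rw [PMF.toOuterMeasure_apply_fintype, ENNReal.ofReal_sum_of_nonneg]
  · refine Finset.sum_congr rfl fun x _ => ?_
    by_cases h : x ∈ S
    · rw [Set.indicator_of_mem h, if_pos h, ← ENNReal.toReal_prod, ENNReal.ofReal_toReal]
      · rfl
      · exact ENNReal.prod_ne_top fun t _ => p.apply_ne_top _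
    · rw [Set.indicator_of_notMem h, if_neg h, ENNReal.ofReal_zero]
  · intro x _
    split_ifs
    · exact Finset.prod_nonneg fun t _ => ENNReal.toReal_nonneg
    · exact le_rfl

lemma sum_toReal_eq_one {X : Type*} [Fintype X] (p : PMF X) : ∑ x, (p x).toReal = 1 := by
  rw [← ENNReal.toReal_sum fun x _ => p.apply_ne_top x, ← tsum_fintype (L := .unconditional _),
    p.tsum_coe, ENNReal.toReal_one]

lemma lt_avgDist_iff {X Y : Type*} (d : X → Y → ℝ≥0) (D : ℝ) {n : ℕ} (hn : 0 < n)
    (x : Fin n → X) (y : Fin n → Y) :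
    D < avgDist d x y ↔ n * D < ∑ t, (d (x t) (y t) : ℝ) := by
  have hn' : (0 : ℝ) < n := Nat.cast_pos.2 hn
  rw [avgDist, one_div, ← div_eq_inv_mul, lt_div_iff₀ hn', mul_comm]

/-- The factor 1/2 pays for the integer part in the exponent. -/
lemma half_exp_le_card_msg (R : ℝ≥0) (n : ℕ) :
    Real.exp (n * (R * Real.log 2)) / 2 ≤ ((2 ^ ⌊(n : ℝ≥0) * R⌋₊ : ℕ) : ℝ) := by
  have h1 : (n : ℝ) * R ≤ (⌊(n : ℝ≥0) * R⌋₊ : ℝ) + 1 := by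
    have := (Nat.lt_floor_add_one ((n : ℝ≥0) * R)).le
    exact_mod_cast this
  have h2 : Real.exp (n * (R * Real.log 2)) ≤
      Real.exp (((⌊(n : ℝ≥0) * R⌋₊ : ℝ) + 1) * Real.log 2) := by
    refine Real.exp_le_exp.2 ?_
    rw [← mul_assoc]
    exact mul_le_mul_of_nonneg_right h1 (Real.log_nonneg (by norm_num))
  rw [add_mul, Real.exp_add, one_mul, Real.exp_log two_pos,
    Real.exp_nat_mul (Real.log 2) ⌊(n : ℝ≥0) * R⌋₊, Real.exp_log two_pos] at h2
  push_cast
  linarith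

lemma card_msg_le_exp (R : ℝ≥0) (n : ℕ) :
    ((2 ^ ⌊(n : ℝ≥0) * R⌋₊ : ℕ) : ℝ) ≤ Real.exp (n * (R * Real.log 2)) := by
  have h1 : (⌊(n : ℝ≥0) * R⌋₊ : ℝ) ≤ (n : ℝ) * R := by
    have := Nat.floor_le (show 0 ≤ (n : ℝ≥0) * R from zero_le)
    exact_mod_cast this
  rw [← mul_assoc]
  have := Real.exp_le_exp.2 (mul_le_mul_of_nonneg_right h1 (Real.log_nonneg one_le_two))
  rw [Real.exp_nat_mul, Real.exp_log two_pos] at this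
  exact_mod_cast this

open Classical in
/-- Rate-distortion achievability under the probability of excess distortion criterion. -/
lemma exists_codesWithin {X Y : Type*} [Fintype X] [Fintype Y] (p : PMF X) (d : X → Y → ℝ≥0)
    (D : ℝ) (R : ℝ≥0) {V : X → Y → ℝ} (hV : V ∈ channels X Y)
    (hR : mutInfo (fun x => (p x).toReal) V < R * Real.log 2)
    (hD : Tendsto (fun n : ℕ => ∑ x : Fin n → X, ∑ y : Fin n → Y,
      (if n * D < ∑ t, (d (x t) (y t) : ℝ) then ∏ t, (p (x t)).toReal * V (x t) (y t) else 0))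
      atTop (𝓝 0)) :
    ∃ s : SourceCode X Y R, CodesWithin p d D s := by
  have hP : ∀ x, 0 ≤ (p x).toReal := fun x => ENNReal.toReal_nonneg
  have hP1 := sum_toReal_eq_one p
  -- Above the mutual information, so the density tail vanishes; below the rate, so the codebook
  -- size times exp(-nρ) diverges.
  obtain ⟨ρ, hρ1, hρ2⟩ := exists_between hR
  choose c hc using fun n : ℕ => exists_codebook_of_channel hP hP1 hV
    (fun x y => (d x y : ℝ)) D ρ n (2 ^ ⌊(n : ℝ≥0) * R⌋₊)
  have hexp : Tendsto (fun n : ℕ => Real.exp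
      (-(((2 ^ ⌊(n : ℝ≥0) * R⌋₊ : ℕ) : ℝ) * Real.exp (-(n * ρ))))) atTop (𝓝 0) := by
    refine Real.tendsto_exp_atBot.comp (tendsto_neg_atTop_atBot.comp ?_)
    have h1 : Tendsto (fun n : ℕ => Real.exp (n * (R * Real.log 2 - ρ)) / 2) atTop atTop :=
      (Real.tendsto_exp_atTop.comp (tendsto_natCast_atTop_atTop.atTop_mul_const
        (sub_pos.2 hρ2))).atTop_div_const two_pos
    refine tendsto_atTop_mono (fun n => ?_) h1
    have h2 := mul_le_mul_of_nonneg_right (half_exp_le_card_msg R n) (Real.exp_pos (-(n * ρ))).le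
    refine le_trans (le_of_eq ?_) h2
    rw [div_mul_eq_mul_div, ← Real.exp_add]
    congr 2
    ring
  have hlim := (hD.add (tendsto_empiricalMean_tail hP hP1 hV hρ1)).add hexp
  simp only [add_zero] at hlim
  -- The default message 0 is used only for uncovered words, already counted as failures.
  let enc : ∀ n, (Fin n → X) → Msg R n := fun n x =>
    if h : ∃ k, ∑ t, (d (x t) (c n k t) : ℝ) ≤ n * D then h.choose else 0
  refine ⟨fun n => PMF.pure (enc n, c n), ?_⟩
  have hlim' := ENNReal.tendsto_ofReal hlim
  rw [ENNReal.ofReal_zero] at hlim'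
  refine tendsto_of_tendsto_of_tendsto_of_le_of_le' tendsto_const_nhds hlim'
    (Eventually.of_forall fun _ => zero_le) ?_
  filter_upwards [eventually_gt_atTop 0] with n hn
  rw [PMF.pure_bind, PMF.toOuterMeasure_map_apply, iid_toOuterMeasure]
  refine ENNReal.ofReal_le_ofReal (le_trans (Finset.sum_le_sum fun x _ => ?_) (hc n))
  have h0 : 0 ≤ ∏ t, (p (x t)).toReal := Finset.prod_nonneg fun t _ => hP _
  by_cases h : ∃ k, ∑ t, (d (x t) (c n k t) : ℝ) ≤ n * D
  · rw [if_pos h, if_neg]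
    rw [Set.mem_preimage, Set.mem_ofPred_eq, lt_avgDist_iff d D hn, not_lt]
    simp only [enc, dif_pos h]
    exact h.choose_spec
  · rw [if_neg h]
    split_ifs
    exacts [le_rfl, h0]

open Classical in
/-- A channel of small mutual information yields a source code when the distortion level is either
above the least expected distortion or attained almost surely. -/
lemma exists_codesWithin_of_avgLoss_le {X Y : Type*} [Fintype X] [Fintype Y] (p : PMF X)
    (d : X → Y → ℝ≥0) (D : ℝ) (R : ℝ≥0) {y₀ : X → Y} (hy₀ : ∀ x y, d x (y₀ x) ≤ d x y)
    (hdrift : ∑ x, (p x).toReal * ((d x (y₀ x) : ℝ) - D) < 0 ∨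
      ∀ x, (p x).toReal ≠ 0 → (d x (y₀ x) : ℝ) - D = 0)
    {V : X → Y → ℝ} (hV : V ∈ channels X Y)
    (hVD : avgLoss (fun x => (p x).toReal) (fun x y => (d x y : ℝ)) V ≤ D)
    (hR : mutInfo (fun x => (p x).toReal) V < R * Real.log 2) :
    ∃ s : SourceCode X Y R, CodesWithin p d D s := by
  have hP : ∀ x, 0 ≤ (p x).toReal := fun x => ENNReal.toReal_nonneg
  have hP1 := sum_toReal_eq_one p
  rcases hdrift with hneg | hzero
  · set W : X → Y → ℝ := fun x => Pi.single (y₀ x) 1 with hWdef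
    have hW : W ∈ channels X Y := fun x => single_mem_stdSimplex ℝ (y₀ x)
    have hWD : avgLoss (fun x => (p x).toReal) (fun x y => (d x y : ℝ)) W < D := by
      have h1 : avgLoss (fun x => (p x).toReal) (fun x y => (d x y : ℝ)) W
          = ∑ x, (p x).toReal * (d x (y₀ x) : ℝ) := by
        refine Finset.sum_congr rfl fun x _ => ?_
        simp [hWdef, Pi.single_apply]
      simp_rw [mul_sub] at hneg
      rw [Finset.sum_sub_distrib, ← Finset.sum_mul, hP1, one_mul] at hneg
      linarith
    set δ := R * Real.log 2 - mutInfo (fun x => (p x).toReal) V with hδ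
    have hδ0 : 0 < δ := sub_pos.2 hR
    set e := mutInfo (fun x => (p x).toReal) W - mutInfo (fun x => (p x).toReal) V with he
    -- A weight on the least-distortion channel so small that the mutual information stays below the
    -- rate, while the loss becomes strictly less than D.
    set a := δ / (δ + |e| + 1) with ha
    have hden : 0 < δ + |e| + 1 := by positivity
    have ha0 : 0 < a := by positivity
    have ha1 : a < 1 := (div_lt_one hden).2 (by linarith [abs_nonneg e])
    have hae : a * e < δ := by
      calc a * e ≤ a * |e| := mul_le_mul_of_nonneg_left (le_abs_self e) ha0.le
        _ = δ * |e| / (δ + |e| + 1) := by rw [ha]; ring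
        _ < δ := by
          rw [div_lt_iff₀ hden]
          nlinarith [abs_nonneg e]
    have hU : (1 - a) • V + a • W ∈ channels X Y :=
      convex_channels hV hW (by linarith) ha0.le (by ring)
    refine exists_codesWithin p d D R hU ?_ ?_
    · have := mutInfo_combo_le hP hV hW (by linarith : 0 ≤ 1 - a) ha0.le
      nlinarith
    · have hlt : avgLoss (fun x => (p x).toReal) (fun x y => (d x y : ℝ)) ((1 - a) • V + a • W)
          < D := by
        rw [avgLoss_combo]
        nlinarith [mul_le_mul_of_nonneg_left hVD (by linarith : 0 ≤ 1 - a),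
          mul_lt_mul_of_pos_left hWD ha0]
      have hp : ∀ (n : ℕ) (x : Fin n → X) (y : Fin n → Y),
          0 ≤ ∏ t, (p (x t)).toReal * ((1 - a) • V + a • W) (x t) (y t) := fun n x y =>
        Finset.prod_nonneg fun t _ => mul_nonneg (hP _) ((hU _).1 _)
      refine squeeze_zero (fun n => ?_) (fun n => ?_) (tendsto_empiricalMean_tail hP hP1 hU hlt)
      · refine Finset.sum_nonneg fun x _ => Finset.sum_nonneg fun y _ => ?_
        split_ifs
        exacts [hp n x y, le_rfl]
      · refine Finset.sum_le_sum fun x _ => Finset.sum_le_sum fun y _ => ?_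
        by_cases h : n * D < ∑ t, (d (x t) (y t) : ℝ)
        · rw [if_pos h, if_pos h.le]
        · rw [if_neg h]
          split_ifs
          exacts [hp n x y, le_rfl]
  -- No slack here: every distortion is at least D on the support and the mean is at most D, so the
  -- distortion is D almost surely and is never exceeded.
  · refine exists_codesWithin p d D R hV hR ?_
    have hterm : ∀ x y, 0 ≤ (p x).toReal * (V x y * ((d x y : ℝ) - D)) := by
      intro x y
      by_cases hx : (p x).toReal = 0
      · rw [hx, zero_mul]
      · have h1 := hzero x hx
        have h2 : (d x (y₀ x) : ℝ) ≤ d x y := NNReal.coe_le_coe.2 (hy₀ x y)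
        exact mul_nonneg (hP x) (mul_nonneg ((hV x).1 y) (by linarith))
    have hsum : ∑ x, ∑ y, (p x).toReal * (V x y * ((d x y : ℝ) - D)) = 0 := by
      refine le_antisymm ?_ (Finset.sum_nonneg fun x _ => Finset.sum_nonneg fun y _ => hterm x y)
      have h1 : ∑ x, ∑ y, (p x).toReal * (V x y * ((d x y : ℝ) - D))
          = avgLoss (fun x => (p x).toReal) (fun x y => (d x y : ℝ)) V - D := by
        have h2 : D = ∑ x, ∑ y, (p x).toReal * (V x y * D) := by
          simp_rw [← Finset.mul_sum, ← Finset.sum_mul, (hV _).2, one_mul]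
          rw [← Finset.sum_mul, hP1, one_mul]
        conv_rhs => rw [h2, avgLoss]
        rw [← Finset.sum_sub_distrib]
        refine Finset.sum_congr rfl fun x _ => ?_
        rw [← Finset.sum_sub_distrib]
        exact Finset.sum_congr rfl fun y _ => by rw [← mul_sub, ← mul_sub]
      linarith
    have hall : ∀ x y, (p x).toReal * V x y ≠ 0 → (d x y : ℝ) = D := by
      intro x y h
      have h1 := (Finset.sum_eq_zero_iff_of_nonneg fun x _ =>
        Finset.sum_nonneg fun y _ => hterm x y).1 hsum x (Finset.mem_univ x)
      have h2 := (Finset.sum_eq_zero_iff_of_nonneg fun y _ => hterm x y).1 h1 y (Finset.mem_univ y)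
      rw [← mul_assoc] at h2
      linarith [(mul_eq_zero.1 h2).resolve_left h]
    refine tendsto_const_nhds.congr fun n => ?_
    refine (Finset.sum_eq_zero fun x _ => Finset.sum_eq_zero fun y _ => ?_).symm
    split_ifs with h
    · by_contra hne
      have hne' := Finset.prod_ne_zero_iff.1 hne
      rw [Finset.sum_congr rfl fun t ht => hall _ _ (hne' t ht)] at h
      simp at h
    · rfl

lemma tendsto_of_tendsto_ofReal {f : ℕ → ℝ} (hf : ∀ n, 0 ≤ f n)
    (h : Tendsto (fun n => ENNReal.ofReal (f n)) atTop (𝓝 0)) : Tendsto f atTop (𝓝 0) := by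
  have := (ENNReal.tendsto_toReal ENNReal.zero_ne_top).comp h
  rw [ENNReal.toReal_zero] at this
  exact this.congr fun n => ENNReal.toReal_ofReal (hf n)

open Classical in
/-- Below the rate-distortion function, a typical source sequence is within the distortion level of
any fixed reproduction sequence with probability exponentially smaller than the number of
messages. -/
lemma exists_typical_sets {X Y : Type*} [Fintype X] [Fintype Y] (p : PMF X) (d : X → Y → ℝ≥0)
    (D : ℝ) (R : ℝ≥0) (hR : (R : ℝ≥0∞) < rateDistortion p d D)
    (hf : Tendsto (fun n => (iid p n).toOuterMeasure {x | ∀ y : Fin n → Y, D < avgDist d x y})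
      atTop (𝓝 0)) :
    ∃ (T : ∀ n, Set (Fin n → X)) (τ ε : ℕ → ℝ≥0), Tendsto τ atTop (𝓝 0) ∧
      Tendsto ε atTop (𝓝 0) ∧ (∀ n, (iid p n).toOuterMeasure (T n)ᶜ ≤ τ n) ∧
      ∀ n, 0 < n → ∀ y : Fin n → Y, ((2 ^ ⌊(n : ℝ≥0) * R⌋₊ : ℕ) : ℝ≥0∞) *
        (iid p n).toOuterMeasure {x | x ∈ T n ∧ avgDist d x y ≤ D} ≤ ε n := by
  have hP : ∀ x, 0 ≤ (p x).toReal := fun x => ENNReal.toReal_nonneg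
  have hP1 := sum_toReal_eq_one p
  have hPn : ∀ (n : ℕ) (x : Fin n → X), 0 ≤ ∏ t, (p (x t)).toReal := fun n x =>
    Finset.prod_nonneg fun t _ => hP _
  -- With no reproduction letters, every source word of positive length would count as infeasible.
  have hY : Nonempty Y := by
    by_contra hY
    rw [not_nonempty_iff] at hY
    refine one_ne_zero (tendsto_nhds_unique (tendsto_const_nhds.congr' ?_) hf)
    filter_upwards [eventually_gt_atTop 0] with n hn
    rw [eq_comm, PMF.toOuterMeasure_apply_eq_one_iff]
    intro x _ y
    exact hY.elim (y ⟨0, hn⟩)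
  choose y₀ hy₀ using fun x => Finite.exists_min (d x)
  -- Some reproduction word meets D exactly when the letterwise best one does, so `hf` says that the
  -- walk with steps d(x, y₀ x) - D is asymptotically nonpositive.
  have hdrift := drift_neg_or_eq_zero (g := fun x => (d x (y₀ x) : ℝ) - D) hP hP1 (by
    refine tendsto_of_tendsto_ofReal (fun n => Finset.sum_nonneg fun x _ => ?_) ?_
    · split_ifs
      exacts [hPn n x, le_rfl]
    refine tendsto_of_tendsto_of_tendsto_of_le_of_le' tendsto_const_nhds hf
      (Eventually.of_forall fun _ => zero_le) ?_
    filter_upwards [eventually_gt_atTop 0] with n hn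
    rw [iid_toOuterMeasure]
    refine ENNReal.ofReal_le_ofReal (Finset.sum_le_sum fun x _ => ?_)
    by_cases h : 0 < ∑ t, ((d (x t) (y₀ (x t)) : ℝ) - D)
    · rw [if_pos h, if_pos]
      intro y
      rw [lt_avgDist_iff d D hn]
      have h1 : ∑ t, (d (x t) (y₀ (x t)) : ℝ) ≤ ∑ t, (d (x t) (y t) : ℝ) :=
        Finset.sum_le_sum fun t _ => NNReal.coe_le_coe.2 (hy₀ _ _)
      simp only [Finset.sum_sub_distrib, Finset.sum_const, Finset.card_univ, Fintype.card_fin,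
        nsmul_eq_mul] at h
      linarith
    · rw [if_neg h]
      split_ifs
      exacts [hPn n x, le_rfl])
  -- The room up to `R'` leaves a ρ above `R` in nats: a channel of information at most ρ would
  -- yield a code of the unachievable rate `R'`.
  obtain ⟨R', hR1, hR2⟩ := ENNReal.lt_iff_exists_nnreal_btwn.1 hR
  have hlog : 0 < Real.log 2 := Real.log_pos one_lt_two
  have hRR' : (R : ℝ) * Real.log 2 < R' * Real.log 2 :=
    mul_lt_mul_of_pos_right (NNReal.coe_lt_coe.2 (ENNReal.coe_lt_coe.1 hR1)) hlog
  obtain ⟨ρ, hρ1, hρ2⟩ := exists_between hRR'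
  have hnone : ∀ V ∈ channels X Y,
      avgLoss (fun x => (p x).toReal) (fun x y => (d x y : ℝ)) V ≤ D →
      ρ < mutInfo (fun x => (p x).toReal) V := by
    intro V hV hVD
    by_contra! hle
    have := exists_codesWithin_of_avgLoss_le p d D R' hy₀ hdrift hV hVD (hle.trans_lt hρ2)
    exact hR2.not_ge (iInf₂_le R' this)
  have hmin : ∃ V ∈ channels X Y,
      avgLoss (fun x => (p x).toReal) (fun x y => (d x y : ℝ)) V ≤ D := by
    refine ⟨fun x => Pi.single (y₀ x) 1, fun x => single_mem_stdSimplex ℝ (y₀ x), ?_⟩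
    have h1 : avgLoss (fun x => (p x).toReal) (fun x y => (d x y : ℝ))
        (fun x => Pi.single (y₀ x) 1) - D = ∑ x, (p x).toReal * ((d x (y₀ x) : ℝ) - D) := by
      simp_rw [mul_sub]
      rw [Finset.sum_sub_distrib, ← Finset.sum_mul, hP1, one_mul]
      congr 1
      refine Finset.sum_congr rfl fun x _ => ?_
      simp [Pi.single_apply]
    have h2 : ∑ x, (p x).toReal * ((d x (y₀ x) : ℝ) - D) ≤ 0 := by
      rcases hdrift with h | h
      · exact h.le
      · refine le_of_eq (Finset.sum_eq_zero fun x _ => ?_)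
        by_cases hx : (p x).toReal = 0
        · rw [hx, zero_mul]
        · rw [h x hx, mul_zero]
    linarith
  obtain ⟨l, hl, hlag⟩ := exists_lagrange hP _ hmin hnone
  obtain ⟨α, hα, hcert, V, hV, hVα⟩ := exists_dual_certificate hP hP1
    (fun x y => (d x y : ℝ)) l
  have hgap := (hlag V hV).trans_le hVα
  obtain ⟨r, hr0, hr1, hr⟩ := exists_pow_tail_bound
    (g := fun x => ρ + l * D - Real.log (α x)) hP hP1 (by
      simp_rw [mul_sub]
      rw [Finset.sum_sub_distrib, ← Finset.sum_mul, hP1, one_mul]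
      linarith)
  -- Typical means that the empirical mean of log α exceeds ρ + lD, a level strictly below its
  -- expectation.
  refine ⟨fun n => {x | n * (ρ + l * D) < ∑ t, Real.log (α (x t))},
    fun n => (r ^ n).toNNReal, fun n => (Real.exp (n * (R * Real.log 2 - ρ))).toNNReal,
    ?_, ?_, fun n => ?_, fun n hn y => ?_⟩
  · have := tendsto_real_toNNReal (tendsto_pow_atTop_nhds_zero_of_lt_one hr0 hr1)
    rwa [Real.toNNReal_zero] at this
  · have h1 : Tendsto (fun n : ℕ => (n : ℝ) * (R * Real.log 2 - ρ)) atTop atBot :=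
      tendsto_natCast_atTop_atTop.atTop_mul_const_of_neg (sub_neg.2 hρ1)
    have := tendsto_real_toNNReal (Real.tendsto_exp_atBot.comp h1)
    rwa [Real.toNNReal_zero] at this
  · rw [iid_toOuterMeasure]
    refine ENNReal.ofReal_le_ofReal (le_trans (le_of_eq ?_) (hr n))
    refine Finset.sum_congr rfl fun x _ => ?_
    simp only [Finset.sum_sub_distrib, Finset.sum_const, Finset.card_univ, Fintype.card_fin,
      nsmul_eq_mul, sub_nonneg, Set.mem_compl_iff, Set.mem_ofPred_eq, not_lt]
  · rw [iid_toOuterMeasure, ← ENNReal.ofReal_natCast, ← ENNReal.ofReal_mul (Nat.cast_nonneg _)]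
    refine ENNReal.ofReal_le_ofReal ?_
    have h1 := packing_bound (D := D) (ρ := ρ) hP hα hl hcert y
    have h2 : ∑ x : Fin n → X, (if x ∈ {x : Fin n → X |
          x ∈ {x : Fin n → X | n * (ρ + l * D) < ∑ t, Real.log (α (x t))} ∧ avgDist d x y ≤ D}
          then ∏ t, (p (x t)).toReal else 0) ≤ Real.exp (-(n * ρ)) := by
      refine le_trans (le_of_eq (Finset.sum_congr rfl fun x _ => ?_)) h1
      simp only [Set.mem_ofPred_eq, ← not_lt (a := D), lt_avgDist_iff d D hn,
        ← not_lt (a := (n : ℝ) * D)]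
    calc _ ≤ Real.exp (n * (R * Real.log 2)) * Real.exp (-(n * ρ)) :=
          mul_le_mul (card_msg_le_exp R n) h2 (Finset.sum_nonneg fun x _ => by
            split_ifs
            exacts [hPn n x, le_rfl]) (Real.exp_pos _).le
      _ = Real.exp (n * (R * Real.log 2 - ρ)) := by rw [← Real.exp_add]; congr 1; ring

/-! ### Expectations under discrete laws -/

section Mean

variable {α β : Type*}

/-- The expectation of an extended nonnegative function. -/
noncomputable def mean (p : PMF α) (f : α → ℝ≥0∞) : ℝ≥0∞ := ∑' a, p a * f a

lemma toOuterMeasure_bind (p : PMF α) (f : α → PMF β) (s : Set β) :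
    (p.bind f).toOuterMeasure s = mean p fun a => (f a).toOuterMeasure s :=
  PMF.toOuterMeasure_bind_apply p f s

lemma mean_bind (p : PMF α) (f : α → PMF β) (g : β → ℝ≥0∞) :
    mean (p.bind f) g = mean p fun a => mean (f a) g := by
  simp only [mean, PMF.bind_apply, ← ENNReal.tsum_mul_right, ← ENNReal.tsum_mul_left, mul_assoc]
  exact ENNReal.tsum_comm

lemma mean_pure (a : α) (g : α → ℝ≥0∞) : mean (PMF.pure a) g = g a := by
  classical
  rw [mean, tsum_eq_single a]
  · simp
  · intro b hb
    simp [hb]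

lemma mean_map (p : PMF α) (f : α → β) (g : β → ℝ≥0∞) :
    mean (p.map f) g = mean p fun a => g (f a) := by
  rw [PMF.map, mean_bind]
  simp only [Function.comp_apply, mean_pure]

lemma mean_comm (p : PMF α) (q : PMF β) (g : α → β → ℝ≥0∞) :
    (mean p fun a => mean q fun b => g a b) = mean q fun b => mean p fun a => g a b := by
  simp only [mean, ← ENNReal.tsum_mul_left, mul_left_comm]
  rw [ENNReal.tsum_comm]

lemma mean_mono (p : PMF α) {f g : α → ℝ≥0∞} (h : ∀ a, f a ≤ g a) : mean p f ≤ mean p g :=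
  ENNReal.tsum_le_tsum fun a => mul_le_mul_right (h a) _

lemma mean_const (p : PMF α) (c : ℝ≥0∞) : (mean p fun _ => c) = c := by
  rw [mean, ENNReal.tsum_mul_right, p.tsum_coe, one_mul]

lemma mean_le (p : PMF α) {f : α → ℝ≥0∞} {c : ℝ≥0∞} (h : ∀ a, f a ≤ c) : mean p f ≤ c :=
  (mean_mono p h).trans_eq (mean_const p c)

lemma mean_add (p : PMF α) (f g : α → ℝ≥0∞) :
    (mean p fun a => f a + g a) = mean p f + mean p g := by
  simp only [mean, mul_add]
  exact ENNReal.tsum_add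

lemma mean_sum {ι : Type*} (p : PMF α) (s : Finset ι) (f : ι → α → ℝ≥0∞) :
    (mean p fun a => ∑ k ∈ s, f k a) = ∑ k ∈ s, mean p (f k) := by
  classical
  induction s using Finset.induction_on with
  | empty => simpa using mean_const p 0
  | insert k s hk ih => simp only [Finset.sum_insert hk, mean_add, ih]

lemma toOuterMeasure_eq_mean (p : PMF α) (s : Set α) :
    p.toOuterMeasure s = mean p (s.indicator 1) := by
  rw [PMF.toOuterMeasure_apply, mean]
  refine tsum_congr fun a => ?_
  by_cases h : a ∈ s <;> simp [h]

lemma toOuterMeasure_le_one (p : PMF α) (s : Set α) : p.toOuterMeasure s ≤ 1 := by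
  rw [toOuterMeasure_eq_mean]
  exact mean_le p fun a => Set.indicator_le_self' (fun _ _ => zero_le_one) a

end Mean

/-! ### Independent families and resampling of a coordinate -/

section Indep

variable {ι : Type*} [Fintype ι] {α β : ι → Type*} [∀ k, Finite (α k)] [∀ k, Finite (β k)]

lemma indep_apply (p : ∀ k, PMF (α k)) (f : ∀ k, α k) : indep p f = ∏ k, p k (f k) := rfl

lemma indep_bind_indep (p : ∀ k, PMF (α k)) (K : ∀ k, α k → PMF (β k)) :
    ((indep p).bind fun f => indep fun k => K k (f k)) = indep fun k => (p k).bind (K k) := by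
  classical
  have (k : ι) : Fintype (α k) := Fintype.ofFinite (α k)
  ext g
  simp only [PMF.bind_apply, indep_apply, tsum_fintype]
  rw [Finset.prod_univ_sum, Fintype.piFinset_univ]
  exact Finset.sum_congr rfl fun f _ => Finset.prod_mul_distrib.symm

lemma indep_pure (a : ∀ k, α k) : (indep fun k => PMF.pure (a k)) = PMF.pure a := by
  classical
  ext f
  rw [indep_apply, PMF.pure_apply]
  by_cases h : f = a
  · simp [h]
  · obtain ⟨k, hk⟩ := Function.ne_iff.1 h
    rw [if_neg h]
    exact Finset.prod_eq_zero (Finset.mem_univ k) (by simp [hk])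

lemma indep_map (p : ∀ k, PMF (α k)) (φ : ∀ k, α k → β k) :
    (indep p).map (fun f k => φ k (f k)) = indep fun k => (p k).map (φ k) := by
  have := indep_bind_indep p fun k => PMF.pure ∘ φ k
  simp only [Function.comp_apply, indep_pure] at this
  exact this

-- The product form lets the update kernel be multiplied into a product law coordinate by
-- coordinate.
open Classical in
lemma map_update_apply [DecidableEq ι] {k : ι} (p : PMF (α k)) (f g : ∀ k, α k) :
    p.map (Function.update f k) g
      = p (g k) * ∏ l, (if l ≠ k → f l = g l then (1 : ℝ≥0∞) else 0) := by
  classical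
  rw [PMF.map_apply]
  by_cases h : ∀ l, l ≠ k → f l = g l
  · rw [Finset.prod_eq_one fun l _ => if_pos (h l), mul_one, tsum_eq_single (g k)]
    · rw [if_pos]
      refine funext fun l => ?_
      by_cases hl : l = k
      · subst hl; simp
      · rw [Function.update_of_ne hl, h l hl]
    · intro a ha
      rw [if_neg]
      intro hg
      exact ha (by rw [hg, Function.update_self])
  · push Not at h
    obtain ⟨l, hl, hfl⟩ := h
    rw [Finset.prod_eq_zero (Finset.mem_univ l) (if_neg fun h => hfl (h hl)), mul_zero]
    refine ENNReal.tsum_eq_zero.2 fun a => if_neg fun hg => hfl ?_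
    rw [hg, Function.update_of_ne hl]

/-- Resampling one coordinate does not change the joint law of independent variables. -/
lemma indep_resample [DecidableEq ι] (p : ∀ k, PMF (α k)) (k : ι) :
    ((indep p).bind fun f => (p k).map (Function.update f k)) = indep p := by
  classical
  have (k : ι) : Fintype (α k) := Fintype.ofFinite (α k)
  ext g
  rw [PMF.bind_apply, tsum_fintype]
  have hterm : ∀ f : ∀ k, α k, indep p f * (p k).map (Function.update f k) g
      = p k (g k) * ∏ l, (p l (f l) * (if l ≠ k → f l = g l then (1 : ℝ≥0∞) else 0)) :=
    fun f => by
      rw [map_update_apply, indep_apply, mul_left_comm, Finset.prod_mul_distrib]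
  rw [Finset.sum_congr rfl fun f _ => hterm f, ← Finset.mul_sum, indep_apply]
  have h := Finset.prod_univ_sum (fun l => (Finset.univ : Finset (α l)))
    (fun l a => p l a * (if l ≠ k → a = g l then (1 : ℝ≥0∞) else 0))
  rw [Fintype.piFinset_univ] at h
  rw [← h, ← Finset.mul_prod_erase _ _ (Finset.mem_univ k),
    ← Finset.mul_prod_erase _ (fun l => p l (g l)) (Finset.mem_univ k)]
  have h1 : ∑ a, p k a * (if k ≠ k → a = g k then (1 : ℝ≥0∞) else 0) = 1 := by
    simp only [ne_eq, not_true_eq_false, false_imp_iff, if_true, mul_one]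
    rw [← tsum_fintype (L := .unconditional _)]
    exact (p k).tsum_coe
  rw [h1, one_mul]
  congr 1
  refine Finset.prod_congr rfl fun l hl => ?_
  have hlk : l ≠ k := Finset.ne_of_mem_erase hl
  simp [hlk]

/-- Changing one coordinate by a kernel that preserves its law does not change the joint law of
independent variables. -/
lemma indep_update [DecidableEq ι] (p : ∀ k, PMF (α k)) (k : ι) {κ : α k → PMF (α k)}
    (hκ : (p k).bind κ = p k) :
    ((indep p).bind fun f => (κ (f k)).map (Function.update f k)) = indep p := by
  conv_lhs => rw [← indep_resample p k]
  conv_rhs => rw [← indep_resample p k, ← hκ]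
  rw [PMF.bind_bind]
  congr 1
  funext f
  rw [PMF.bind_map, PMF.map_bind]
  congr 1
  funext a
  have : Function.update (Function.update f k a) k = Function.update f k :=
    funext fun b => Function.update_idem a b f
  rw [Function.comp_apply, Function.update_self, this]

lemma indep_map_eval (p : ∀ k, PMF (α k)) (k : ι) : (indep p).map (fun f => f k) = p k := by
  classical
  conv_lhs => rw [← indep_resample p k]
  rw [PMF.map_bind]
  simp only [PMF.map_comp]
  have : ∀ f : ∀ k, α k, (fun f : ∀ k, α k => f k) ∘ Function.update f k = id := fun f => by
    funext a; simp
  simp only [this, PMF.map_id, PMF.bind_const]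

end Indep

section DoublyIndexed

variable {N : ℕ} {α β : Fin N → Fin N → Type*} [∀ i j, Finite (α i j)] [∀ i j, Finite (β i j)]

lemma indep₂_bind_indep₂ (p : ∀ i j, PMF (α i j)) (K : ∀ i j, α i j → PMF (β i j)) :
    ((indep fun i => indep (p i)).bind fun f => indep fun i => indep fun j => K i j (f i j))
      = indep fun i => indep fun j => (p i j).bind (K i j) := by
  rw [indep_bind_indep (fun i => indep (p i)) fun i f => indep fun j => K i j (f j)]
  simp only [indep_bind_indep]

lemma indep₂_map (p : ∀ i j, PMF (α i j)) (φ : ∀ i j, α i j → β i j) :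
    (indep fun i => indep (p i)).map (fun f i j => φ i j (f i j))
      = indep fun i => indep fun j => (p i j).map (φ i j) := by
  rw [indep_map (fun i => indep (p i)) fun i f j => φ i j (f j)]
  simp only [indep_map]

lemma indep₂_map_eval (p : ∀ i j, PMF (α i j)) (i j : Fin N) :
    (indep fun i => indep (p i)).map (fun f => f i j) = p i j := by
  rw [← indep_map_eval (p i) j, ← indep_map_eval (fun i => indep (p i)) i, PMF.map_comp]
  rfl

end DoublyIndexed

/-! ### Dithered source codes and the separation architecture -/

lemma map_uniform_equiv {α : Type*} [Fintype α] [Nonempty α] (e : α ≃ α) :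
    (PMF.uniformOfFintype α).map e = PMF.uniformOfFintype α := by
  classical
  ext b
  rw [PMF.map_apply, tsum_eq_single (e.symm b)]
  · simp
  · intro a ha
    rw [if_neg]
    rintro rfl
    simp at ha

/-- A source code may be used at any larger rate with uniformly distributed messages. -/
lemma exists_uniform_code {X Y : Type*} [Finite X] (p : PMF X) (d : X → Y → ℝ≥0) (D : ℝ)
    {R' R : ℝ≥0} (hR : R' ≤ R) {s' : SourceCode X Y R'} (hs' : CodesWithin p d D s') :
    ∃ s : SourceCode X Y R, CodesWithin p d D s ∧
      ∀ n x, (s n).map (fun c => c.1 x) = PMF.uniformOfFintype (Msg R n) := by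
  have hle : ∀ n : ℕ, 2 ^ ⌊(n : ℝ≥0) * R'⌋₊ ≤ 2 ^ ⌊(n : ℝ≥0) * R⌋₊ := fun n =>
    Nat.pow_le_pow_right two_pos (Nat.floor_le_floor (mul_le_mul_right hR _))
  let emb : ∀ n, Msg R' n → Msg R n := fun n => Fin.castLE (hle n)
  -- The default 0 is never reached from a correctly carried message, which lies in the embedded
  -- range once the shift is removed.
  let ret : ∀ n, Msg R n → Msg R' n := fun n m =>
    if h : m.val < 2 ^ ⌊(n : ℝ≥0) * R'⌋₊ then ⟨m.val, h⟩ else 0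
  have hret : ∀ n a, ret n (emb n a) = a := fun n a => by
    simp only [ret, emb, Fin.val_castLE, a.isLt, dif_pos]
  -- A one-time pad: a uniform cyclic shift, shared by encoder and decoder, cancels between them.
  let shift : ∀ n, DetSourceCode X Y R' n → Msg R n → DetSourceCode X Y R n := fun n c u =>
    (fun x => emb n (c.1 x) + u, fun m => c.2 (ret n (m - u)))
  refine ⟨fun n => (s' n).bind fun c => (PMF.uniformOfFintype (Msg R n)).map (shift n c), ?_, ?_⟩
  · refine hs'.congr fun n => ?_
    congr 1
    rw [PMF.bind_bind]
    refine congrArg PMF.toOuterMeasure (congrArg (PMF.bind (s' n)) (funext fun c => ?_))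
    rw [PMF.bind_map]
    simp only [Function.comp_def, shift, add_sub_cancel_right, hret, PMF.bind_const]
  · intro n x
    rw [PMF.map_bind]
    have : ∀ c, ((PMF.uniformOfFintype (Msg R n)).map (shift n c)).map (fun c => c.1 x)
        = PMF.uniformOfFintype (Msg R n) := fun c => by
      rw [PMF.map_comp]
      exact map_uniform_equiv (Equiv.addLeft (emb n (c.1 x)))
    simp only [this, PMF.bind_const]

section Network

variable {N : ℕ} {I O : Fin N → Type*} {X Y : Fin N → Fin N → Type*}
  [∀ i j, Finite (X i j)] [∀ i j, Finite (Y i j)]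

/-- Each message is uniform conditionally on its source word, and the codes and sources are
independent over the pairs. -/
lemma message_law (p : ∀ i j, PMF (X i j)) {R : Fin N → Fin N → ℝ≥0}
    {s : ∀ i j, SourceCode (X i j) (Y i j) (R i j)}
    (hs : ∀ i j n x, (s i j n).map (fun c => c.1 x) = PMF.uniformOfFintype (Msg (R i j) n))
    (n : ℕ) :
    ((indep fun i => indep fun j => s i j n).bind fun c =>
      (sourceLaw p n).map fun x i j => (c i j).1 (x i j)) = uniformMessages R n := by
  have h1 : ∀ c : ∀ i j, DetSourceCode (X i j) (Y i j) (R i j) n,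
      ((sourceLaw p n).map fun x i j => (c i j).1 (x i j))
        = indep fun i => indep fun j => (iid (p i j) n).map (c i j).1 := fun c =>
    indep₂_map (fun i j => iid (p i j) n) fun i j => (c i j).1
  have h2 : ∀ i j, ((s i j n).bind fun c => (iid (p i j) n).map c.1)
      = PMF.uniformOfFintype (Msg (R i j) n) := fun i j => by
    have h3 : ((s i j n).bind fun c => (iid (p i j) n).map c.1)
        = (iid (p i j) n).bind fun x => (s i j n).map fun c => c.1 x :=
      PMF.bind_comm _ _ _
    simp only [h3, hs, PMF.bind_const]
  simp only [h1]
  rw [indep₂_bind_indep₂ (fun i j => s i j n) fun i j c => (iid (p i j) n).map c.1]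
  simp only [h2]
  rfl

/-- The codes are independent of the medium modems, so they can be averaged out first; the medium
modems then see uniform messages. -/
lemma inputLaw_separation (p : ∀ i j, PMF (X i j)) {R : Fin N → Fin N → ℝ≥0}
    {s : ∀ i j, SourceCode (X i j) (Y i j) (R i j)}
    (hs : ∀ i j n x, (s i j n).map (fun c => c.1 x) = PMF.uniformOfFintype (Msg (R i j) n))
    (hc : MessageModems I O R) (n : ℕ) :
    inputLaw (separation s hc n) (sourceLaw p n) = inputLaw (hc n) (uniformMessages R n) := by
  have h1 : inputLaw (separation s hc n) (sourceLaw p n)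
      = (indep fun i => indep fun j => s i j n).bind fun c => (hc n).bind fun g =>
        ((sourceLaw p n).map fun x i j => (c i j).1 (x i j)).map fun w i => (g i).1 (w i) := by
    rw [inputLaw, separation, PMF.bind_bind]
    congr 1
    funext c
    rw [PMF.bind_map]
    congr 1
    funext g
    rw [PMF.map_comp]
    rfl
  rw [h1, PMF.bind_comm, inputLaw]
  congr 1
  funext g
  rw [← message_law p hs n, PMF.map_bind]

lemma interconnect_separation {R : Fin N → Fin N → ℝ≥0}
    (s : ∀ i j, SourceCode (X i j) (Y i j) (R i j)) (hc : MessageModems I O R) (n : ℕ)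
    (m : (∀ i, Fin n → I i) → PMF (∀ i, Fin n → O i)) (x : ∀ i j, Fin n → X i j) :
    interconnect (separation s hc n) m x
      = (indep fun i => indep fun j => s i j n).bind fun c =>
        (interconnect (hc n) m fun i j => (c i j).1 (x i j)).map
          fun v i j => (c i j).2 ((v i j).getD 0) := by
  rw [interconnect, separation, PMF.bind_bind]
  congr 1
  funext c
  rw [PMF.bind_map, interconnect, PMF.map_bind]
  congr 1
  funext g
  rw [PMF.map_comp]
  rfl

/-- Excess distortion needs either a message error, controlled for every message tuple because the
criterion is maximal, or a failure of the source code itself. -/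
lemma communicates_separation {p : ∀ i j, PMF (X i j)} {d : ∀ i j, X i j → Y i j → ℝ≥0}
    {D : Fin N → Fin N → ℝ} {R : Fin N → Fin N → ℝ≥0}
    {s : ∀ i j, SourceCode (X i j) (Y i j) (R i j)}
    (hs : ∀ i j, CodesWithin (p i j) (d i j) (D i j) (s i j)) {B : Set (Medium I O)}
    {hc : MessageModems I O R} (hB : Reliable B hc) :
    Communicates B p d D (separation s hc) := by
  classical
  obtain ⟨δ, hδ, herr⟩ := hB
  set ex : Fin N → Fin N → ℕ → ℝ≥0∞ := fun i j n =>
    ((s i j n).bind fun c => (iid (p i j) n).map fun x => (x, c.2 (c.1 x))).toOuterMeasure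
      {xy | D i j < avgDist (d i j) xy.1 xy.2} with hex
  have hfin : ∀ i j n, ex i j n ≠ ∞ := fun i j n =>
    ((toOuterMeasure_le_one _ _).trans_lt ENNReal.one_lt_top).ne
  refine ⟨fun i j n => δ i j n + (ex i j n).toNNReal, fun i j => ?_, fun m hm n hn i j => ?_⟩
  · have h1 := (ENNReal.tendsto_toNNReal ENNReal.zero_ne_top).comp (hs i j)
    rw [ENNReal.toNNReal_zero] at h1
    have h2 := (hδ i j).add h1
    rwa [add_zero] at h2
  rw [ENNReal.coe_add, ENNReal.coe_toNNReal (hfin i j n), toOuterMeasure_bind]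
  set bad : (Fin n → X i j) → DetSourceCode (X i j) (Y i j) (R i j) n → ℝ≥0∞ := fun x c =>
    if D i j < avgDist (d i j) x (c.2 (c.1 x)) then 1 else 0 with hbad
  have hstep : ∀ x : ∀ i j, Fin n → X i j,
      ((interconnect (separation s hc n) (m n) x).map fun y => (x, y)).toOuterMeasure
          {xy | D i j < avgDist (d i j) (xy.1 i j) (xy.2 i j)}
        ≤ δ i j n + mean (s i j n) fun c => bad (x i j) c := by
    intro x
    rw [PMF.toOuterMeasure_map_apply, interconnect_separation, toOuterMeasure_bind]
    have hmarg : (mean (s i j n) fun c => bad (x i j) c)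
        = mean (indep fun i => indep fun j => s i j n) fun c => bad (x i j) (c i j) := by
      rw [← mean_map _ (fun c : ∀ i j, DetSourceCode (X i j) (Y i j) (R i j) n => c i j),
        indep₂_map_eval fun i j => s i j n]
    rw [hmarg, ← mean_const (indep fun i => indep fun j => s i j n) (δ i j n : ℝ≥0∞), ← mean_add]
    refine mean_mono _ fun c => ?_
    rw [PMF.toOuterMeasure_map_apply]
    by_cases hb : D i j < avgDist (d i j) (x i j) ((c i j).2 ((c i j).1 (x i j)))
    · refine (toOuterMeasure_le_one _ _).trans (le_trans ?_ le_add_self)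
      simp only [hbad, if_pos hb, le_refl]
    · refine le_trans ?_ le_self_add
      refine le_trans (MeasureTheory.measure_mono ?_)
        (herr m hm n hn (fun i j => (c i j).1 (x i j)) i j)
      intro v hv hvw
      refine hb ?_
      have hv' : D i j < avgDist (d i j) (x i j) ((c i j).2 ((v i j).getD 0)) := hv
      rwa [hvw, Option.getD_some] at hv'
  refine (mean_mono _ hstep).trans ?_
  rw [mean_add, mean_const]
  refine add_le_add_right (le_of_eq ?_) _
  have h1 : (mean (sourceLaw p n) fun x => mean (s i j n) fun c => bad (x i j) c)
      = mean (iid (p i j) n) fun x => mean (s i j n) fun c => bad x c := by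
    rw [← indep₂_map_eval (fun i j => iid (p i j) n) i j, mean_map]
    rfl
  rw [h1, mean_comm, hex]
  dsimp only
  rw [toOuterMeasure_bind]
  congr 1
  funext c
  rw [PMF.toOuterMeasure_map_apply, toOuterMeasure_eq_mean]
  congr 1

end Network

/-! ### Random coding over source modems -/

open Classical in
/-- Decode to the only message whose codeword passes the test, and declare an error if there is no
such message. -/
noncomputable def decode {W S T : Type*} (A : S → T → Prop) (C : W → S) (y : T) : Option W :=
  if h : ∃ w, A (C w) y ∧ ∀ w', A (C w') y → w' = w then some h.choose else none

lemma decode_eq {W S T : Type*} {A : S → T → Prop} {C : W → S} {y : T} {w : W}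
    (hw : A (C w) y) (hu : ∀ w', A (C w') y → w' = w) : decode A C y = some w := by
  have h : ∃ w, A (C w) y ∧ ∀ w', A (C w') y → w' = w := ⟨w, hw, hu⟩
  rw [decode, dif_pos h, h.choose_spec.2 w hw]

section Network

variable {N : ℕ} {I O : Fin N → Type*} {X Y : Fin N → Fin N → Type*} [∀ i j, Finite (X i j)]

/-- Independent random codebooks, with independent codewords distributed as the sources. -/
noncomputable def codebookLaw (p : ∀ i j, PMF (X i j)) (R : Fin N → Fin N → ℝ≥0) (n : ℕ) :
    PMF (∀ i j, Msg (R i j) n → Fin n → X i j) :=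
  indep fun i => indep fun j => indep fun _ : Msg (R i j) n => iid (p i j) n

/-- For each message tuple, this makes the coded modems indistinguishable from the source modems at
the medium inputs. -/
lemma codebookLaw_map_eval (p : ∀ i j, PMF (X i j)) (R : Fin N → Fin N → ℝ≥0) {n : ℕ}
    (w : ∀ i j, Msg (R i j) n) :
    (codebookLaw p R n).map (fun C i j => C i j (w i j)) = sourceLaw p n := by
  rw [codebookLaw, indep₂_map (fun i j => indep fun _ : Msg (R i j) n => iid (p i j) n)
    fun i j C => C (w i j)]
  simp only [indep_map_eval]
  rfl

/-- Allows an unsent codeword to be redrawn, hence treated as independent of the sent codewords and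
of the reproductions. -/
lemma codebookLaw_resample (p : ∀ i j, PMF (X i j)) (R : Fin N → Fin N → ℝ≥0) {n : ℕ}
    (i j : Fin N) (w : Msg (R i j) n) :
    ((codebookLaw p R n).bind fun C => (iid (p i j) n).map fun a =>
      Function.update C i (Function.update (C i) j (Function.update (C i j) w a)))
      = codebookLaw p R n := by
  have h1 := indep_resample (fun _ : Msg (R i j) n => iid (p i j) n) w
  have h2 := indep_update (fun j => indep fun _ : Msg (R i j) n => iid (p i j) n) j h1
  have h3 := indep_update (fun i => indep fun j => indep fun _ : Msg (R i j) n => iid (p i j) n)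
    i h2
  simp only [PMF.map_comp] at h3
  exact h3

/-- Modems for sources used to send messages: the codewords of the messages take the place of the
sources, and their reproductions are decoded. -/
noncomputable def codedDet {R : Fin N → Fin N → ℝ≥0} {n : ℕ}
    (A : ∀ i j, (Fin n → X i j) → (Fin n → Y i j) → Prop)
    (C : ∀ i j, Msg (R i j) n → Fin n → X i j)
    (g : DetModems I O (fun i j => Fin n → X i j) (fun i j => Fin n → Y i j) n) :
    DetModems I O (fun i j => Msg (R i j) n) (fun i j => Option (Msg (R i j) n)) n :=
  fun i =>
    (fun w => (g i).1 fun j => C i j (w j),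
     fun w o j => decode (A j i) (C j i) ((g i).2 (fun k => C i k (w k)) o j))

/-- The message modems obtained from source modems by random coding. -/
noncomputable def codedModems (p : ∀ i j, PMF (X i j)) (R : Fin N → Fin N → ℝ≥0)
    (A : ∀ i j n, (Fin n → X i j) → (Fin n → Y i j) → Prop) (h : SourceModems I O X Y) :
    MessageModems I O R :=
  fun n => (codebookLaw p R n).bind fun C => (h n).map (codedDet (fun i j => A i j n) C)

/-- The input law is already the source one for each fixed message tuple, so averaging over `q`
changes nothing. -/
lemma inputLaw_codedModems (p : ∀ i j, PMF (X i j)) (R : Fin N → Fin N → ℝ≥0)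
    (A : ∀ i j n, (Fin n → X i j) → (Fin n → Y i j) → Prop) (h : SourceModems I O X Y) (n : ℕ)
    (q : PMF (∀ i j, Msg (R i j) n)) :
    inputLaw (codedModems p R A h n) q = inputLaw (h n) (sourceLaw p n) := by
  have h1 : inputLaw (codedModems p R A h n) q
      = (codebookLaw p R n).bind fun C => q.bind fun w => (h n).map
        fun g i => (g i).1 fun j => C i j (w i j) := by
    rw [inputLaw, codedModems, PMF.bind_bind]
    congr 1
    funext C
    rw [PMF.bind_map]
    exact PMF.bind_comm _ _ _
  have h2 : ∀ w : ∀ i j, Msg (R i j) n, ((codebookLaw p R n).bind fun C => (h n).map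
        fun g i => (g i).1 fun j => C i j (w i j)) = inputLaw (h n) (sourceLaw p n) := by
    intro w
    rw [inputLaw, ← codebookLaw_map_eval p R w]
    simp only [PMF.map_comp]
    exact PMF.bind_comm _ _ _
  rw [h1, PMF.bind_comm]
  simp only [h2, PMF.bind_const]

lemma interconnect_codedModems (p : ∀ i j, PMF (X i j)) (R : Fin N → Fin N → ℝ≥0)
    (A : ∀ i j n, (Fin n → X i j) → (Fin n → Y i j) → Prop) (h : SourceModems I O X Y) (n : ℕ)
    (m : (∀ i, Fin n → I i) → PMF (∀ i, Fin n → O i)) (w : ∀ i j, Msg (R i j) n) :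
    interconnect (codedModems p R A h n) m w = (codebookLaw p R n).bind fun C =>
      (interconnect (h n) m fun i j => C i j (w i j)).map
        fun y i j => decode (A i j n) (C i j) (y i j) := by
  rw [interconnect, codedModems, PMF.bind_bind]
  congr 1
  funext C
  rw [PMF.bind_map, interconnect, PMF.map_bind]
  congr 1
  funext g
  rw [PMF.map_comp]
  rfl

/-- The random coding bound on the error probability. -/
lemma error_le (p : ∀ i j, PMF (X i j)) (R : Fin N → Fin N → ℝ≥0)
    (A : ∀ i j n, (Fin n → X i j) → (Fin n → Y i j) → Prop) (h : SourceModems I O X Y) (n : ℕ)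
    (m : (∀ i, Fin n → I i) → PMF (∀ i, Fin n → O i)) (w : ∀ i j, Msg (R i j) n) (i j : Fin N)
    {η ε : ℝ≥0∞}
    (hη : (mean (sourceLaw p n) fun x =>
      (interconnect (h n) m x).toOuterMeasure {y | ¬ A i j n (x i j) (y i j)}) ≤ η)
    (hε : ∀ y, ((2 ^ ⌊(n : ℝ≥0) * R i j⌋₊ - 1 : ℕ) : ℝ≥0∞) *
      (iid (p i j) n).toOuterMeasure {x | A i j n x y} ≤ ε) :
    (interconnect (codedModems p R A h n) m w).toOuterMeasure {v | v i j ≠ some (w i j)}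
      ≤ η + ε := by
  classical
  set Ic : (∀ i j, Fin n → X i j) → PMF (∀ i j, Fin n → Y i j) := interconnect (h n) m with hIc
  set sent : (∀ i j, Msg (R i j) n → Fin n → X i j) → ∀ i j, Fin n → X i j :=
    fun C i j => C i j (w i j) with hsent
  -- Decoding fails only if the sent codeword is rejected or some other one is accepted.
  have hunion : ∀ C : ∀ i j, Msg (R i j) n → Fin n → X i j,
      ((Ic (sent C)).map fun y i j => decode (A i j n) (C i j) (y i j)).toOuterMeasure
          {v | v i j ≠ some (w i j)}
        ≤ (Ic (sent C)).toOuterMeasure {y | ¬ A i j n (sent C i j) (y i j)} +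
          ∑ w' ∈ Finset.univ.erase (w i j),
            (Ic (sent C)).toOuterMeasure {y | A i j n (C i j w') (y i j)} := by
    intro C
    rw [PMF.toOuterMeasure_map_apply]
    have hsub : (fun (y : ∀ i j, Fin n → Y i j) i j => decode (A i j n) (C i j) (y i j)) ⁻¹'
          {v | v i j ≠ some (w i j)}
        ⊆ {y | ¬ A i j n (sent C i j) (y i j)} ∪
          ⋃ w' ∈ Finset.univ.erase (w i j), {y | A i j n (C i j w') (y i j)} := by
      intro y hy
      by_contra hcon
      simp only [Set.mem_union, Set.mem_iUnion, Set.mem_ofPred_eq, not_or, not_not, not_exists]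
        at hcon
      refine hy (decode_eq hcon.1 fun w' hw' => ?_)
      by_contra hne
      exact hcon.2 w' (Finset.mem_erase.2 ⟨hne, Finset.mem_univ _⟩) hw'
    exact (MeasureTheory.measure_mono hsub).trans ((MeasureTheory.measure_union_le _ _).trans
      (add_le_add_right (MeasureTheory.measure_biUnion_finset_le _ _) _))
  rw [interconnect_codedModems, toOuterMeasure_bind]
  refine (mean_mono _ hunion).trans ?_
  rw [mean_add, mean_sum]
  refine add_le_add ?_ ?_
  · refine le_trans (le_of_eq ?_) hη
    rw [← codebookLaw_map_eval p R w, mean_map]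
  · have hother : ∀ w' ∈ Finset.univ.erase (w i j), (mean (codebookLaw p R n) fun C =>
        (Ic (sent C)).toOuterMeasure {y | A i j n (C i j w') (y i j)})
        ≤ mean (codebookLaw p R n) fun C => mean (Ic (sent C)) fun y =>
          (iid (p i j) n).toOuterMeasure {x | A i j n x (y i j)} := by
      intro w' hw'
      have hne : w' ≠ w i j := Finset.ne_of_mem_erase hw'
      conv_lhs => rw [← codebookLaw_resample p R i j w', mean_bind]
      refine mean_mono _ fun C => le_of_eq ?_
      rw [mean_map]
      -- Redrawing the codeword of `w'` leaves the sent ones untouched, since `w'` differs from the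
      -- message.
      have hs : ∀ a, sent (Function.update C i
          (Function.update (C i) j (Function.update (C i j) w' a))) = sent C := by
        intro a
        funext k l
        simp only [hsent]
        by_cases hk : k = i
        · subst hk
          rw [Function.update_self]
          by_cases hl : l = j
          · subst hl
            rw [Function.update_self, Function.update_of_ne hne.symm]
          · rw [Function.update_of_ne hl]
        · rw [Function.update_of_ne hk]
      simp only [hs, Function.update_self, toOuterMeasure_eq_mean]
      rw [mean_comm]
      rfl
    -- Only wrong messages are counted: the factor 2^⌊nR⌋ - 1 vanishes at rate zero.
    refine (Finset.sum_le_sum hother).trans ?_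
    rw [Finset.sum_const, Finset.card_erase_of_mem (Finset.mem_univ _), Finset.card_univ,
      Fintype.card_fin, nsmul_eq_mul, mean, ← ENNReal.tsum_mul_left]
    simp only [mul_left_comm _ (codebookLaw p R n _)]
    refine mean_le (codebookLaw p R n) fun C => ?_
    rw [mean, ← ENNReal.tsum_mul_left]
    simp only [mul_left_comm _ (Ic (sent C) _)]
    exact mean_le (Ic (sent C)) fun y => hε (y i j)

lemma communicates_expr (p : ∀ i j, PMF (X i j)) (h : SourceModems I O X Y) (n : ℕ)
    (m : (∀ i, Fin n → I i) → PMF (∀ i, Fin n → O i))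
    (E : Set ((∀ i j, Fin n → X i j) × (∀ i j, Fin n → Y i j))) :
    ((sourceLaw p n).bind fun x => (interconnect (h n) m x).map fun y => (x, y)).toOuterMeasure E
      = mean (sourceLaw p n) fun x =>
        (interconnect (h n) m x).toOuterMeasure {y | (x, y) ∈ E} := by
  rw [toOuterMeasure_bind]
  simp only [PMF.toOuterMeasure_map_apply]
  rfl

lemma mean_sourceLaw_eval (p : ∀ i j, PMF (X i j)) (n : ℕ) (i j : Fin N)
    (f : (Fin n → X i j) → ℝ≥0∞) :
    (mean (sourceLaw p n) fun x => f (x i j)) = mean (iid (p i j) n) f := by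
  rw [← indep₂_map_eval (fun i j => iid (p i j) n) i j, mean_map]
  rfl

/-- The decoding tests of the random coding argument. -/
lemma exists_test [∀ i j, Finite (Y i j)] {p : ∀ i j, PMF (X i j)}
    {d : ∀ i j, X i j → Y i j → ℝ≥0} {D : Fin N → Fin N → ℝ} {B : Set (Medium I O)}
    (hne : B.Nonempty) {h : SourceModems I O X Y} (hB : Communicates B p d D h)
    {R : Fin N → Fin N → ℝ≥0} (i j : Fin N)
    (hR : (R i j : ℝ≥0∞) < rateDistortion (p i j) (d i j) (D i j) ∨ R i j = 0) :
    ∃ (A : ∀ n, (Fin n → X i j) → (Fin n → Y i j) → Prop) (η ε : ℕ → ℝ≥0),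
      Tendsto η atTop (𝓝 0) ∧ Tendsto ε atTop (𝓝 0) ∧
      (∀ m ∈ B, ∀ n, 0 < n → (mean (sourceLaw p n) fun x =>
        (interconnect (h n) (m n) x).toOuterMeasure {y | ¬ A n (x i j) (y i j)}) ≤ η n) ∧
      ∀ n : ℕ, 0 < n → ∀ y, ((2 ^ ⌊(n : ℝ≥0) * R i j⌋₊ - 1 : ℕ) : ℝ≥0∞) *
        (iid (p i j) n).toOuterMeasure {x | A n x y} ≤ ε n := by
  classical
  rcases hR with hR | hR
  · obtain ⟨ω, hω, hcom⟩ := hB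
    have : Fintype (X i j) := Fintype.ofFinite _
    have : Fintype (Y i j) := Fintype.ofFinite _
    -- Source words with no admissible reproduction make `h` fail surely, so a single medium in `B`
    -- bounds their probability.
    have hfeas : Tendsto (fun n => (iid (p i j) n).toOuterMeasure
        {x | ∀ y : Fin n → Y i j, D i j < avgDist (d i j) x y}) atTop (𝓝 0) := by
      obtain ⟨m, hm⟩ := hne
      refine tendsto_of_tendsto_of_tendsto_of_le_of_le' tendsto_const_nhds
        (ENNReal.tendsto_coe.2 (hω i j)) (Eventually.of_forall fun _ => zero_le) ?_
      filter_upwards [eventually_gt_atTop 0] with n hn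
      refine le_trans ?_ (hcom m hm n hn i j)
      rw [communicates_expr, toOuterMeasure_eq_mean, ← mean_sourceLaw_eval]
      refine mean_mono _ fun x => ?_
      by_cases hx : x i j ∈ {x | ∀ y : Fin n → Y i j, D i j < avgDist (d i j) x y}
      · rw [Set.indicator_of_mem hx, Pi.one_apply, (PMF.toOuterMeasure_apply_eq_one_iff _ _).2]
        exact fun y _ => hx (y i j)
      · rw [Set.indicator_of_notMem hx]
        exact zero_le
    obtain ⟨T, τ, ε, hτ, hε, hT, hpack⟩ :=
      exists_typical_sets (p i j) (d i j) (D i j) (R i j) hR hfeas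
    refine ⟨fun n x y => x ∈ T n ∧ avgDist (d i j) x y ≤ D i j, fun n => ω i j n + τ n, ε,
      ?_, hε, fun m hm n hn => ?_, fun n hn y => ?_⟩
    · have := (hω i j).add hτ
      rwa [add_zero] at this
    · have h1 := hcom m hm n hn i j
      rw [communicates_expr] at h1
      have h2 := hT n
      rw [toOuterMeasure_eq_mean, ← mean_sourceLaw_eval p n i j] at h2
      rw [ENNReal.coe_add]
      refine le_trans ?_ (add_le_add h1 h2)
      rw [← mean_add]
      refine mean_mono _ fun x => ?_
      by_cases hx : x i j ∈ T n
      · refine le_trans (MeasureTheory.measure_mono ?_) le_self_add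
        intro y hy
        exact not_le.1 fun hle => hy ⟨hx, hle⟩
      · rw [Set.indicator_of_mem (show x i j ∈ (T n)ᶜ from hx), Pi.one_apply]
        exact (toOuterMeasure_le_one _ _).trans le_add_self
    · refine le_trans (mul_le_mul_left ?_ _) (hpack n hn y)
      exact_mod_cast Nat.sub_le _ _
  -- At rate zero there is a single message, and the test that always accepts decodes it.
  · refine ⟨fun _ _ _ => True, fun _ => 0, fun _ => 0, tendsto_const_nhds, tendsto_const_nhds,
      fun m _ n _ => ?_, fun n _ y => ?_⟩
    · refine mean_le _ fun x => ?_
      simp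
    · simp [hR]

lemma exists_reliable [∀ i j, Finite (Y i j)] {p : ∀ i j, PMF (X i j)}
    {d : ∀ i j, X i j → Y i j → ℝ≥0} {D : Fin N → Fin N → ℝ} {B : Set (Medium I O)}
    {h : SourceModems I O X Y} (hB : Communicates B p d D h) {R : Fin N → Fin N → ℝ≥0}
    (hR : ∀ i j, (R i j : ℝ≥0∞) < rateDistortion (p i j) (d i j) (D i j) ∨ R i j = 0) :
    ∃ A : ∀ i j n, (Fin n → X i j) → (Fin n → Y i j) → Prop,
      Reliable B (codedModems p R A h) := by
  -- Over an empty `B` nothing is known about feasibility, but reliability is vacuous.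
  rcases B.eq_empty_or_nonempty with rfl | hne
  · exact ⟨fun _ _ _ _ _ => True, fun _ _ _ => 0, fun _ _ => tendsto_const_nhds,
      fun m hm => hm.elim⟩
  · choose A η ε hη hε h1 h2 using fun i j => exists_test hne hB i j (hR i j)
    refine ⟨A, fun i j n => η i j n + ε i j n, fun i j => ?_, fun m hm n hn w i j => ?_⟩
    · have := (hη i j).add (hε i j)
      rwa [add_zero] at this
    · rw [ENNReal.coe_add]
      exact error_le p R A h n (m n) w i j (h1 i j m hm n hn) (h2 i j n hn)

end Network

end Unicast

/-! ### Assembly of the two directions -/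

theorem theorem2 {N : ℕ} {I O : Fin N → Type*} {X Y : Fin N → Fin N → Type*}
    [∀ i, Finite (I i)] [∀ i, Finite (O i)]
    [∀ i j, Finite (X i j)] [∀ i j, Finite (Y i j)]
    (p : ∀ i j, PMF (X i j)) (d : ∀ i j, X i j → Y i j → ℝ≥0) (D : Fin N → Fin N → ℝ) :
    (∀ (B : Set (Unicast.Medium I O)) (h : Unicast.SourceModems I O X Y),
      Unicast.Communicates B p d D h →
      ∀ R : Fin N → Fin N → ℝ≥0,
        (∀ i j, (R i j : ℝ≥0∞) < Unicast.rateDistortion (p i j) (d i j) (D i j) ∨ R i j = 0) →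
        ∃ hc : Unicast.MessageModems I O R,
          Unicast.Reliable B hc ∧
          ∀ q : ∀ n, PMF (∀ i j, Unicast.Msg (R i j) n),
            Unicast.SameOrLesserResources
              (fun n => Unicast.inputLaw (hc n) (q n))
              (fun n => Unicast.inputLaw (h n) (Unicast.sourceLaw p n))) ∧
    (∀ R : Fin N → Fin N → ℝ≥0,
      (∀ i j, Unicast.rateDistortion (p i j) (d i j) (D i j) < (R i j : ℝ≥0∞)) →
      ∃ s : ∀ i j, Unicast.SourceCode (X i j) (Y i j) (R i j),
        (∀ i j, Unicast.CodesWithin (p i j) (d i j) (D i j) (s i j)) ∧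
        ∀ (B : Set (Unicast.Medium I O)) (hc : Unicast.MessageModems I O R),
          Unicast.Reliable B hc →
          Unicast.Communicates B p d D (Unicast.separation s hc) ∧
          Unicast.SameOrLesserResources
            (fun n => Unicast.inputLaw (Unicast.separation s hc n) (Unicast.sourceLaw p n))
            (fun n => Unicast.inputLaw (hc n) (Unicast.uniformMessages R n))) := by
  refine ⟨fun B h hB R hR => ?_, fun R hR => ?_⟩
  · obtain ⟨A, hA⟩ := Unicast.exists_reliable hB hR
    refine ⟨Unicast.codedModems p R A h, hA, fun q ρ i => le_of_eq ?_⟩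
    exact congrArg (ρ i) (funext fun n => Unicast.inputLaw_codedModems p R A h n (q n))
  · have hcode : ∀ i j, ∃ s : Unicast.SourceCode (X i j) (Y i j) (R i j),
        Unicast.CodesWithin (p i j) (d i j) (D i j) s ∧ ∀ n x, (s n).map (fun c => c.1 x)
          = PMF.uniformOfFintype (Unicast.Msg (R i j) n) := by
      intro i j
      -- The infimum need not be attained: strict inequality supplies a code at some rate below `R i
      -- j`, which is then padded and dithered.
      obtain ⟨R', hR'⟩ := iInf_lt_iff.1 (hR i j)
      obtain ⟨⟨s', hs'⟩, hlt⟩ := iInf_lt_iff.1 hR'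
      exact Unicast.exists_uniform_code _ _ _ (ENNReal.coe_lt_coe.1 hlt).le hs'
    choose s hs hu using hcode
    refine ⟨s, hs, fun B hc hB => ⟨Unicast.communicates_separation hs hB, fun ρ i => le_of_eq ?_⟩⟩
    exact congrArg (ρ i) (funext fun n => Unicast.inputLaw_separation p hu hc n)
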